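/- Theorem 3.4. Let $A=(a_{i,j})\in\mathbb R^{n\times n}$ be an irreducible nonsingular M-matrix (that is, $a_{i,j}\le 0$ for $i\ne j$, $A$ is invertible with entrywise nonnegative inverse, and no simultaneous permutation of rows and columns makes $A$ block upper triangular with two nonempty square diagonal blocks) all of whose diagonal entries are $1$. Let $Q=(q_{i,j})\in\mathbb R^{n\times n}$ satisfy $q_{i,i}=0$ for all $i$, $q_{i,j}\ge 0$ for $i\neq j$, and $\sum_{i\ne j}q_{i,j}\ne 0$. Put $P_1=I+Q$ and $A^{(1)}=P_1A=(a^{(1)}_{i,j})$, and suppose that $P_1A$ is a Z-matrix, i.e. $a^{(1)}_{i,j}\le 0$ for $i\ne j$. Let $0<\omega\le 1$ and $0\le\gamma\le 1$. For a matrix $B=D-L-U$, with $D$ diagonal, $L$ strictly lower and $U$ strictly upper triangular, the AOR iteration matrix is $(D-\gamma L)^{-1}[(1-\omega)D+(\omega-\gamma)L+\omega U]$; write $\mathscr L_{\gamma,\omega}$ and $\mathscr L^{(1)}_{\gamma,\omega}$ for the AOR iteration matrices of $A$ and of $P_1A$, and $\rho$ for the spectral radius. With $A=I-L-U$, let $Q^{(l)},Q^{(u)}$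 be the strictly lower and strictly upper triangular parts of $Q$, let $E_1,F_1$ be the diagonal and strictly lower triangular parts of $Q^{(l)}U$ and $E_2,F_2$ those of $Q^{(u)}L$, and let $\delta_{i,j}$ be the entries of $E_1+E_2+F_1+F_2+Q^{(u)}U$. Then $$\rho(\mathscr L^{(1)}_{\gamma,\omega})<\rho(\mathscr L_{\gamma,\omega})<1,$$ provided that (I) or (II) holds. (I) One of the following conditions (i)–(iv) holds. (i) $0\le\gamma<1$ and $P_1A$ is irreducible. (ii) $\gamma=1$, $P_1A$ is irreducible, and one of the following holds: ($ii_1$) $\delta_{i,j}>0$ for some $i,j\in\{1,\dots,n\}$; ($ii_2$) $q_{n,1}>0$; ($ii_3$) $q_{k,k+1}>0$ for some $k\in\{1,\dots,n-1\}$; ($ii_4$) $q_{i,j}a_{j,i}<0$ for some $i,j\in\{1,\dots,n\}$; ($ii_5$) $q_{i,n}a_{n,j}<0$ for some $i\in\{1,\dots,n-1\}$, $j\in\{1,\dots,i\}$; ($ii_6$) $q_{i,j}a_{j,1}<0$ for some $i\in\{1,\dots,n-1\}$, $j\in\{i+1,\dots,n\}$; ($ii_7$) $q_{i,j}a_{j,j+1}<0$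 for some $i\in\{1,\dots,n\}$, $j\in\{1,\dots,n-1\}$; ($ii_8$) $q_{i,1}a_{1,j}<0$ for some $i\in\{2,\dots,n\}$, $j\in\{2,\dots,i\}$; ($ii_9$) $a_{n,1}<0$ and $a_{k,k+1}<0$ for all $k\in\{1,\dots,n-1\}$. (iii) $0\le\gamma<1$, and for each $i\in\{1,\dots,n-1\}$ there is $j\in\{1,\dots,n\}$ with $q_{i,j}>0$. (iv) $\gamma=1$; for each $i\in\{2,\dots,n-1\}$ one of ($iv_1$)–($iv_7$) holds: ($iv_1$) $\delta_{i,j}>0$ for some $j\in\{1,\dots,n\}$; ($iv_2$) $q_{i,i+1}>0$; ($iv_3$) $q_{i,j}a_{j,i}<0$ for some $j\in\{1,\dots,n\}$; ($iv_4$) $q_{i,n}a_{n,j}<0$ for some $j\in\{1,\dots,i\}$; ($iv_5$) $q_{i,j}a_{j,1}<0$ for some $j\in\{i+1,\dots,n\}$; ($iv_6$) $q_{i,j}a_{j,j+1}<0$ for some $j\in\{1,\dots,n-1\}$; ($iv_7$) $q_{i,1}a_{1,j}<0$ for some $j\in\{2,\dots,i\}$; and, in addition, one of the following holds: ($iv^a$)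 $q_{n,k}a_{k,j}<0$ for some $j\in\{2,\dots,n\}$, $k\in\{1,\dots,j-1\}$; ($iv^b$) $q_{n,1}>0$; ($iv^c$) $a_{n,j}+q_{n,j}+\sum_{1\le k\le n-1,\,k\ne j}q_{n,k}a_{k,j}<0$ for some $j\in\{2,\dots,n-1\}$; ($iv^d$) one of ($iv_1$)–($iv_6$) holds for $i=1$, and $a_{n,1}+q_{n,1}+\sum_{k=2}^{n-1}q_{n,k}a_{k,1}<0$; ($iv^e$) one of ($iv_1$)–($iv_6$) holds for $i=1$, and $a_{n,1}<0$. (II) $a_{i,j}\ge a^{(1)}_{i,j}$ for all $1\le j<i\le n$, and one of the following holds: $a^{(1)}_{i,i}<1$ for some $i\in\{1,\dots,n\}$; or $\gamma>0$ and $a_{i,j}>a^{(1)}_{i,j}$ for some $1\le j<i\le n$. -/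

import Mathlib

namespace AOR

open Matrix

section General

variable {n : ℕ}

/-- The diagonal part of `B`. -/
def diagPart (B : Matrix (Fin n) (Fin n) ℝ) : Matrix (Fin n) (Fin n) ℝ :=
  Matrix.of fun i j => if i = j then B i j else 0

/-- The strictly lower triangular part of `B`. -/
def lowerPart (B : Matrix (Fin n) (Fin n) ℝ) : Matrix (Fin n) (Fin n) ℝ :=
  Matrix.of fun i j => if j < i then B i j else 0

/-- The strictly upper triangular part of `B`. -/
def upperPart (B : Matrix (Fin n) (Fin n) ℝ) : Matrix (Fin n) (Fin n) ℝ :=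
  Matrix.of fun i j => if i < j then B i j else 0

/-- `B` is a Z-matrix: all off-diagonal entries are nonpositive. -/
def IsZMatrix (B : Matrix (Fin n) (Fin n) ℝ) : Prop :=
  ∀ i j, i ≠ j → B i j ≤ 0

/-- `B` is monotone: it is invertible and its inverse is semi-positive, i.e. entrywise
nonnegative with at least one positive entry. -/
def IsMonotone (B : Matrix (Fin n) (Fin n) ℝ) : Prop :=
  IsUnit B ∧ (∀ i j, 0 ≤ B⁻¹ i j) ∧ ∃ i j, 0 < B⁻¹ i j

/-- `B` is a nonsingular M-matrix: a monotone Z-matrix. -/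
def IsNonsingularMMatrix (B : Matrix (Fin n) (Fin n) ℝ) : Prop :=
  IsZMatrix B ∧ IsMonotone B

/-- `B` is reducible: after a simultaneous permutation of rows and columns it is block upper
triangular, with diagonal blocks of orders `r` and `n - r`, where `1 ≤ r ≤ n - 1`. -/
def IsReducible (B : Matrix (Fin n) (Fin n) ℝ) : Prop :=
  ∃ (σ : Equiv.Perm (Fin n)) (r : ℕ), 1 ≤ r ∧ r < n ∧
    ∀ i j : Fin n, r ≤ (i : ℕ) → (j : ℕ) < r → (B.submatrix σ σ) i j = 0

/-- `B` is irreducible: it is not reducible. -/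
def IsIrreducible (B : Matrix (Fin n) (Fin n) ℝ) : Prop :=
  ¬ IsReducible B

/-- The AOR iteration matrix of `B = D - L - U`, that is
`(D - γ L)⁻¹ ((1 - ω) D + (ω - γ) L + ω U)`, where `D = diagPart B`, `L = -lowerPart B` and
`U = -upperPart B`. -/
noncomputable def aorMatrix (γ ω : ℝ) (B : Matrix (Fin n) (Fin n) ℝ) :
    Matrix (Fin n) (Fin n) ℝ :=
  (diagPart B - γ • (-lowerPart B))⁻¹ *
    ((1 - ω) • diagPart B + (ω - γ) • (-lowerPart B) + ω • (-upperPart B))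

/-- The spectral radius of a real matrix: the largest modulus of its complex eigenvalues. -/
noncomputable def rho (B : Matrix (Fin n) (Fin n) ℝ) : ENNReal :=
  spectralRadius ℂ (B.map (algebraMap ℝ ℂ))

/-- `Q` has zero diagonal, nonnegative off-diagonal entries, and the sum of its off-diagonal
entries is nonzero. The preconditioner is then `1 + Q`. -/
structure IsAdmissible (Q : Matrix (Fin n) (Fin n) ℝ) : Prop where
  diag_eq_zero : ∀ i, Q i i = 0
  offDiag_nonneg : ∀ i j, i ≠ j → 0 ≤ Q i j
  sum_ne_zero : ∑ p ∈ (Finset.univ : Finset (Fin n)).offDiag, Q p.1 p.2 ≠ 0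

/-- The matrix `Δ(γ) = (E₁ + E₂) + γ F₁ + γ F₂ + γ Qᵘ U + (1 - γ) Q`, where `A = D - L - U`,
`Qˡ` and `Qᵘ` are the strictly lower and upper parts of `Q`, `E₁` and `F₁` are the diagonal and
strictly lower parts of `Qˡ U`, and `E₂` and `F₂` those of `Qᵘ L`. -/
def Delta (A Q : Matrix (Fin n) (Fin n) ℝ) (γ : ℝ) : Matrix (Fin n) (Fin n) ℝ :=
  (diagPart (lowerPart Q * (-upperPart A)) + diagPart (upperPart Q * (-lowerPart A)))
    + γ • lowerPart (lowerPart Q * (-upperPart A))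
    + γ • lowerPart (upperPart Q * (-lowerPart A))
    + γ • (upperPart Q * (-upperPart A))
    + (1 - γ) • Q

end General

/-! From here on the order of the matrices is `n = m + 1`. The indices `1, …, n` are the elements
of `Fin (m + 1)`, with `1` and `n` being `0` and `Fin.last m`. An index in `{1, …, n - 1}` whose
successor is needed is `k.castSucc` for `k : Fin m`, and its successor is `k.succ`. -/

section Conditions

variable {m : ℕ}

/-- The nine alternatives for `γ = 1` and irreducible `(1 + Q) A`. -/
inductive EntryCond (A Q : Matrix (Fin (m + 1)) (Fin (m + 1)) ℝ) : Prop
  | c1 (h : ∃ i j, 0 < Delta A Q 1 i j)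
  | c2 (h : 0 < Q (Fin.last m) 0)
  | c3 (h : ∃ k : Fin m, 0 < Q k.castSucc k.succ)
  | c4 (h : ∃ i j, Q i j * A j i < 0)
  | c5 (h : ∃ i j, i < Fin.last m ∧ j ≤ i ∧ Q i (Fin.last m) * A (Fin.last m) j < 0)
  | c6 (h : ∃ i j, i < Fin.last m ∧ i < j ∧ Q i j * A j 0 < 0)
  | c7 (h : ∃ (i : Fin (m + 1)) (j : Fin m), Q i j.castSucc * A j.castSucc j.succ < 0)
  | c8 (h : ∃ i j, 0 < i ∧ 0 < j ∧ j ≤ i ∧ Q i 0 * A 0 j < 0)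
  | c9 (h : A (Fin.last m) 0 < 0 ∧ ∀ k : Fin m, A k.castSucc k.succ < 0)

/-- The first six alternatives on the row with index `i.castSucc`. -/
inductive RowCond (A Q : Matrix (Fin (m + 1)) (Fin (m + 1)) ℝ) (i : Fin m) : Prop
  | r1 (h : ∃ j, 0 < Delta A Q 1 i.castSucc j)
  | r2 (h : 0 < Q i.castSucc i.succ)
  | r3 (h : ∃ j, Q i.castSucc j * A j i.castSucc < 0)
  | r4 (h : ∃ j, j ≤ i.castSucc ∧ Q i.castSucc (Fin.last m) * A (Fin.last m) j < 0)
  | r5 (h : ∃ j, i.castSucc < j ∧ Q i.castSucc j * A j 0 < 0)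
  | r6 (h : ∃ j : Fin m, Q i.castSucc j.castSucc * A j.castSucc j.succ < 0)

/-- The seventh alternative on the row with index `i.castSucc`. -/
def RowCond7 (A Q : Matrix (Fin (m + 1)) (Fin (m + 1)) ℝ) (i : Fin m) : Prop :=
  ∃ j, 0 < j ∧ j ≤ i.castSucc ∧ Q i.castSucc 0 * A 0 j < 0

/-- One of the first six row alternatives holds for the first row (which is not the last row). -/
def FirstRowCond (A Q : Matrix (Fin (m + 1)) (Fin (m + 1)) ℝ) : Prop :=
  ∃ i : Fin m, i.castSucc = 0 ∧ RowCond A Q i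

/-- The alternatives that involve the last row. -/
inductive LastRowCond (A Q : Matrix (Fin (m + 1)) (Fin (m + 1)) ℝ) : Prop
  | a (h : ∃ j k, 0 < j ∧ k < j ∧ Q (Fin.last m) k * A k j < 0)
  | b (h : 0 < Q (Fin.last m) 0)
  | c (h : ∃ j, 0 < j ∧ j < Fin.last m ∧
      A (Fin.last m) j + Q (Fin.last m) j
        + ∑ k with k ≠ j ∧ k < Fin.last m, Q (Fin.last m) k * A k j < 0)
  | d (h₁ : FirstRowCond A Q)
      (h₂ : A (Fin.last m) 0 + Q (Fin.last m) 0
        + ∑ k with 0 < k ∧ k < Fin.last m, Q (Fin.last m) k * A k 0 < 0)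
  | e (h₁ : FirstRowCond A Q) (h₂ : A (Fin.last m) 0 < 0)

/-- The four alternative conditions of the Stein-Rosenberg type comparison for the
preconditioner `1 + Q`. -/
inductive SteinRosenbergCond (A Q : Matrix (Fin (m + 1)) (Fin (m + 1)) ℝ) (γ : ℝ) : Prop
  | i (hγ₀ : 0 ≤ γ) (hγ₁ : γ < 1) (hirr : IsIrreducible ((1 + Q) * A))
  | ii (hγ : γ = 1) (hirr : IsIrreducible ((1 + Q) * A)) (h : EntryCond A Q)
  | iii (hγ₀ : 0 ≤ γ) (hγ₁ : γ < 1) (h : ∀ i, i < Fin.last m → ∃ j, 0 < Q i j)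
  | iv (hγ : γ = 1)
      (hrow : ∀ i : Fin m, 0 < i.castSucc → RowCond A Q i ∨ RowCond7 A Q i)
      (hlast : LastRowCond A Q)

/-- The strictly lower entries of `(1 + Q) A` do not exceed those of `A`, and either some diagonal
entry of `(1 + Q) A` is less than `1`, or `γ > 0` and some strictly lower entry decreases. -/
def LowerCond (A Q : Matrix (Fin (m + 1)) (Fin (m + 1)) ℝ) (γ : ℝ) : Prop :=
  (∀ i j, j < i → ((1 + Q) * A) i j ≤ A i j) ∧
    ((∃ i, ((1 + Q) * A) i i < 1) ∨
      (0 < γ ∧ ∃ i j, j < i ∧ ((1 + Q) * A) i j < A i j))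

end Conditions

end AOR

/-! Write `M = D - γL`, `N = (1 - γ)L + U` for the parts of `A` (`aorLeft`, `aorRight`), and `M₁`,
`N₁` for those of `P₁A`. Then `A = M - N` and the AOR matrix is `(1 - ω)I + ω M⁻¹N`, so its spectral
radius is `1 - ω + ωτ` with `τ` the Perron root of `M⁻¹N` (`exists_rho_aorMatrix`). It remains to
compare `τ` with the corresponding `τ₁`, independently of `ω`.

Irreducibility gives `τ > 0` and a vector `x > 0` with `Nx = τMx`; monotonicity of `A` gives `τ <
1`. Put `W = P₁M - M₁`, which equals `Δ(γ) + γQᵘA` (`one_add_mul_aorLeft_sub`). Since `Ax = (1 -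
τ)Mx ≥ 0`, also `Wx ≥ 0`, and `N₁x - τM₁x = -(1 - τ)Wx`. Pairing with a left Perron vector `z` of
the second pencil gives `(τ₁ - τ) zM₁x = -(1 - τ) zWx`. If `τ₁ ≥ τ`, then `zWx = 0`, so `Wx`
vanishes on the support `S` of `z`. The pencil equation for `z` also shows that `P₁A` has no entry
leading out of `S` and that `S` is not a singleton (`rho_lt_or_exists_support`).

Such an `S` is impossible. Under (I), the rows of `Δ(γ)` indexed by `S` vanish; the conditions force
`S` to be everything, or to shrink to at most one index, while providing a positive entry of `Δ(γ)`
or an entry leading out of `S`. Under (II), `W = QM + (M - M₁)` splits `Wx` into two nonnegative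
terms that vanish on `S`; irreducibility of `A` then forces a row of `Q` to be zero where `P₁A` and
`A` differ. -/

namespace AOR

open Matrix

/-! ### Perron–Frobenius theory by compactness. -/

section Perron

variable {ι : Type*} [Fintype ι]

/-- Among all `t` with `t v ≤ T v` for some nonzero `v ≥ 0` there is a largest one. -/
theorem exists_max_subinvariant [Nonempty ι] (T : Matrix ι ι ℝ) (hT : ∀ i j, 0 ≤ T i j) :
    ∃ r : ℝ, 0 ≤ r ∧ r ≤ ∑ i, ∑ j, T i j ∧
      (∃ x ∈ stdSimplex ℝ ι, ∀ i, r * x i ≤ (T *ᵥ x) i) ∧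
      ∀ (t : ℝ) (v : ι → ℝ), (∀ i, 0 ≤ v i) → v ≠ 0 → (∀ i, t * v i ≤ (T *ᵥ v) i) → t ≤ r := by
  classical
  set c := ∑ i, ∑ j, T i j with hc
  have hc0 : 0 ≤ c := Finset.sum_nonneg fun i _ => Finset.sum_nonneg fun j _ => hT i j
  have hbound : ∀ (t : ℝ) (x : ι → ℝ), x ∈ stdSimplex ℝ ι → (∀ i, t * x i ≤ (T *ᵥ x) i) →
      t ≤ c := by
    intro t x hx h
    calc t = ∑ i, t * x i := by rw [← Finset.mul_sum, hx.2, mul_one]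
      _ ≤ ∑ i, (T *ᵥ x) i := Finset.sum_le_sum fun i _ => h i
      _ ≤ c := by
        refine Finset.sum_le_sum fun i _ => Finset.sum_le_sum fun j _ => ?_
        have h1 : x j ≤ 1 := by
          rw [← hx.2]; exact Finset.single_le_sum (fun k _ => hx.1 k) (Finset.mem_univ j)
        exact mul_le_of_le_one_right (hT i j) h1
  -- Normalizing `v` to the simplex makes the admissible pairs `(t, v)` with `t ≥ 0` a compact set,
  -- on which `t` attains its maximum.
  set C : Set (ℝ × (ι → ℝ)) := (Set.Icc 0 c ×ˢ stdSimplex ℝ ι) ∩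
    {p | ∀ i, p.1 * p.2 i ≤ (T *ᵥ p.2) i} with hC
  have hcomp : IsCompact C := by
    refine (isCompact_Icc.prod (isCompact_stdSimplex ℝ ι)).inter_right ?_
    rw [Set.ofPred_forall]
    refine isClosed_iInter fun i => isClosed_le (by fun_prop) ?_
    simp only [mulVec, dotProduct]
    fun_prop
  have hne : C.Nonempty := by
    obtain ⟨i₀⟩ := ‹Nonempty ι›
    refine ⟨(0, Pi.single i₀ 1), ⟨⟨le_rfl, hc0⟩, single_mem_stdSimplex ℝ i₀⟩, fun i => ?_⟩
    simp only [zero_mul]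
    exact Finset.sum_nonneg fun j _ => mul_nonneg (hT i j)
      ((single_mem_stdSimplex ℝ i₀).1 j)
  obtain ⟨p, hp, hmax⟩ := hcomp.exists_isMaxOn hne continuous_fst.continuousOn
  refine ⟨p.1, hp.1.1.1, hp.1.1.2, ⟨p.2, hp.1.2, hp.2⟩, fun t v hv hv0 h => ?_⟩
  rcases le_or_gt t 0 with ht | ht
  · exact ht.trans hp.1.1.1
  have hs : 0 < ∑ i, v i := by
    refine lt_of_le_of_ne (Finset.sum_nonneg fun i _ => hv i) fun h0 => hv0 ?_
    funext i
    exact (Finset.sum_eq_zero_iff_of_nonneg fun i _ => hv i).1 h0.symm i (Finset.mem_univ i)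
  set x : ι → ℝ := (∑ i, v i)⁻¹ • v with hx
  have hxm : x ∈ stdSimplex ℝ ι := by
    refine ⟨fun i => mul_nonneg (inv_nonneg.2 hs.le) (hv i), ?_⟩
    simp only [hx, Pi.smul_apply, smul_eq_mul, ← Finset.mul_sum]
    exact inv_mul_cancel₀ hs.ne'
  have hxt : ∀ i, t * x i ≤ (T *ᵥ x) i := by
    intro i
    rw [hx, mulVec_smul]
    simp only [Pi.smul_apply, smul_eq_mul]
    rw [mul_left_comm]
    exact mul_le_mul_of_nonneg_left (h i) (inv_nonneg.2 hs.le)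
  exact hmax (show (t, x) ∈ C from ⟨⟨⟨ht.le, hbound t x hxm hxt⟩, hxm⟩, hxt⟩)

theorem mulVec_pos_of_pos {T : Matrix ι ι ℝ} (hT : ∀ i j, 0 < T i j) {v : ι → ℝ}
    (hv : ∀ i, 0 ≤ v i) (hv0 : v ≠ 0) (i : ι) : 0 < (T *ᵥ v) i := by
  obtain ⟨j, hj⟩ := Function.ne_iff.1 hv0
  exact Finset.sum_pos' (fun k _ => mul_nonneg (hT i k).le (hv k))
    ⟨j, Finset.mem_univ j, mul_pos (hT i j) (lt_of_le_of_ne (hv j) (Ne.symm hj))⟩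

/-- Perron's theorem for entrywise positive matrices. -/
theorem exists_perron_of_pos [Nonempty ι] (T : Matrix ι ι ℝ) (hT : ∀ i j, 0 < T i j) :
    ∃ r : ℝ, 0 ≤ r ∧ r ≤ ∑ i, ∑ j, T i j ∧ (∃ x ∈ stdSimplex ℝ ι, T *ᵥ x = r • x) ∧
      ∀ (t : ℝ) (v : ι → ℝ), (∀ i, 0 ≤ v i) → v ≠ 0 → (∀ i, t * v i ≤ (T *ᵥ v) i) → t ≤ r := by
  obtain ⟨r, hr0, hrc, ⟨x, hx, hrx⟩, hmax⟩ := exists_max_subinvariant T fun i j => (hT i j).le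
  refine ⟨r, hr0, hrc, ⟨x, hx, ?_⟩, hmax⟩
  by_contra hne
  have hx0 : x ≠ 0 := by
    rintro rfl
    simpa using hx.2
  set u := T *ᵥ x with hu
  have hupos : ∀ i, 0 < u i := mulVec_pos_of_pos hT hx.1 hx0
  have hdpos : ∀ i, 0 < (T *ᵥ (u - r • x)) i :=
    mulVec_pos_of_pos hT (fun i => by simpa using hrx i) (sub_ne_zero.2 hne)
  -- `T(u - r x) = Tu - r u` is strictly positive, so `u = Tx` admits a factor larger than `r`; the
  -- least ratio is a gain valid in every coordinate, against maximality.
  obtain ⟨k, -, hk⟩ := Finset.exists_min_image Finset.univ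
    (fun i => (T *ᵥ (u - r • x)) i / u i) Finset.univ_nonempty
  have hε : 0 < (T *ᵥ (u - r • x)) k / u k := div_pos (hdpos k) (hupos k)
  have := hmax (r + (T *ᵥ (u - r • x)) k / u k) u (fun i => (hupos i).le)
    (fun h => (hupos k).ne' (congrFun h k)) fun i => by
      have h1 := hk i (Finset.mem_univ i)
      rw [le_div_iff₀ (hupos i)] at h1
      have h2 : (T *ᵥ (u - r • x)) i = (T *ᵥ u) i - r * u i := by
        rw [mulVec_sub, mulVec_smul, ← hu]; simp
      rw [add_mul]
      linarith
  linarith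

/-- The Perron–Frobenius theorem for entrywise nonnegative matrices. -/
theorem exists_perron [Nonempty ι] (T : Matrix ι ι ℝ) (hT : ∀ i j, 0 ≤ T i j) :
    ∃ r : ℝ, 0 ≤ r ∧ (∃ x : ι → ℝ, (∀ i, 0 ≤ x i) ∧ x ≠ 0 ∧ T *ᵥ x = r • x) ∧
      ∀ (t : ℝ) (v : ι → ℝ), (∀ i, 0 ≤ v i) → v ≠ 0 → (∀ i, t * v i ≤ (T *ᵥ v) i) → t ≤ r := by
  set ε : ℕ → ℝ := fun k => 1 / ((k : ℝ) + 1) with hεdef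
  have hε0 : ∀ k, 0 < ε k := fun k => Nat.one_div_pos_of_nat
  have hε1 : ∀ k, ε k ≤ 1 := fun k => by
    rw [hεdef]
    exact (div_le_one (by positivity)).2 (by simp)
  have hεlim : Filter.Tendsto ε Filter.atTop (nhds 0) := tendsto_one_div_add_atTop_nhds_zero_nat
  choose r hr0 hrc hx hmax using fun k =>
    (exists_perron_of_pos (T + ε k • Matrix.of fun _ _ => (1 : ℝ))
      (fun i j => by simpa using add_pos_of_nonneg_of_pos (hT i j) (hε0 k)))
  choose x hxm hxe using hx
  -- As `ε k ≤ 1`, the roots of the positive perturbations are uniformly bounded, and a subsequence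
  -- of roots and eigenvectors converges.
  have hrb : ∀ k, r k ∈ Set.Icc 0 (∑ i, ∑ j, (T i j + 1)) := fun k =>
    ⟨hr0 k, (hrc k).trans (Finset.sum_le_sum fun i _ => Finset.sum_le_sum fun j _ => by
      simpa using hε1 k)⟩
  obtain ⟨⟨r', x'⟩, hmem, φ, hφ, hlim⟩ :=
    (isCompact_Icc.prod (isCompact_stdSimplex ℝ ι)).tendsto_subseq
      (x := fun k => (r k, x k)) fun k => ⟨hrb k, hxm k⟩
  have hlr : Filter.Tendsto (fun k => r (φ k)) Filter.atTop (nhds r') :=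
    (continuous_fst.tendsto _).comp hlim
  have hlx : Filter.Tendsto (fun k => x (φ k)) Filter.atTop (nhds x') :=
    (continuous_snd.tendsto _).comp hlim
  have hlε : Filter.Tendsto (fun k => ε (φ k)) Filter.atTop (nhds 0) :=
    hεlim.comp hφ.tendsto_atTop
  have hx'0 : x' ≠ 0 := by
    rintro rfl
    simpa using hmem.2.2
  refine ⟨r', hmem.1.1, ⟨x', hmem.2.1, hx'0, ?_⟩, fun t v hv hv0 h => ?_⟩
  · have hcont : Continuous fun p : ℝ × ℝ × (ι → ℝ) =>
        (T + p.1 • Matrix.of fun _ _ => (1 : ℝ)) *ᵥ p.2.2 - p.2.1 • p.2.2 := by fun_prop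
    have h1 := hcont.continuousAt.tendsto.comp (hlε.prodMk_nhds (hlr.prodMk_nhds hlx))
    have h2 : (fun p : ℝ × ℝ × (ι → ℝ) =>
        (T + p.1 • Matrix.of fun _ _ => (1 : ℝ)) *ᵥ p.2.2 - p.2.1 • p.2.2) ∘
          (fun k => (ε (φ k), r (φ k), x (φ k))) = fun _ => 0 := by
      funext k
      exact sub_eq_zero.2 (hxe (φ k))
    rw [h2] at h1
    have h3 := tendsto_nhds_unique h1 tendsto_const_nhds
    simpa [sub_eq_zero] using h3
  · refine ge_of_tendsto' hlr fun k => hmax (φ k) t v hv hv0 fun i => (h i).trans ?_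
    rw [add_mulVec]
    simp only [Pi.add_apply, le_add_iff_nonneg_right]
    exact Finset.sum_nonneg fun j _ => mul_nonneg (by simpa using (hε0 (φ k)).le) (hv j)

variable [DecidableEq ι]

theorem mem_spectrum_iff_exists_mulVec {K : Type*} [Field K] (B : Matrix ι ι K) (μ : K) :
    μ ∈ spectrum K B ↔ ∃ v, v ≠ 0 ∧ B *ᵥ v = μ • v := by
  rw [← Matrix.spectrum_toLin', ← Module.End.hasEigenvalue_iff_mem_spectrum]
  constructor
  · intro h
    obtain ⟨v, hv⟩ := h.exists_hasEigenvector
    exact ⟨v, hv.2, by simpa using hv.apply_eq_smul⟩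
  · rintro ⟨v, hv, h⟩
    exact Module.End.hasEigenvalue_of_hasEigenvector
      (x := v) ⟨Module.End.mem_eigenspace_iff.2 (by simpa using h), hv⟩

theorem mem_spectrum_transpose_iff {K : Type*} [Field K] (B : Matrix ι ι K) (μ : K) :
    μ ∈ spectrum K Bᵀ ↔ μ ∈ spectrum K B := by
  rw [Matrix.mem_spectrum_iff_isRoot_charpoly, Matrix.mem_spectrum_iff_isRoot_charpoly,
    Matrix.charpoly_transpose]

end Perron

/-! ### The spectral radius as the Perron root. -/

section SpectralRadius

variable {n : ℕ}

theorem rho_transpose (B : Matrix (Fin n) (Fin n) ℝ) : rho Bᵀ = rho B := by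
  unfold rho spectralRadius
  rw [Matrix.transpose_map]
  simp only [mem_spectrum_transpose_iff]

/-- The spectral radius of a nonnegative matrix is its Perron root. -/
theorem rho_eq_ofReal {T : Matrix (Fin n) (Fin n) ℝ} (hT : ∀ i j, 0 ≤ T i j) {r : ℝ}
    (hr : 0 ≤ r) {x : Fin n → ℝ} (hx0 : x ≠ 0) (hx : T *ᵥ x = r • x)
    (hmax : ∀ (t : ℝ) (v : Fin n → ℝ), (∀ i, 0 ≤ v i) → v ≠ 0 →
      (∀ i, t * v i ≤ (T *ᵥ v) i) → t ≤ r) :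
    rho T = ENNReal.ofReal r := by
  unfold rho spectralRadius
  refine le_antisymm (iSup₂_le fun μ hμ => ?_) ?_
  · obtain ⟨v, hv0, hv⟩ := (mem_spectrum_iff_exists_mulVec _ _).1 hμ
    -- The moduli of the coordinates of a complex eigenvector satisfy `‖μ‖ |v| ≤ T |v|` by the
    -- triangle inequality.
    have h : ‖μ‖ ≤ r := by
      refine hmax ‖μ‖ (fun i => ‖v i‖) (fun i => norm_nonneg _) (fun h => hv0 ?_) fun i => ?_
      · funext i
        simpa using congrFun h i
      · have h1 := congrFun hv i
        simp only [Pi.smul_apply, smul_eq_mul] at h1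
        rw [← norm_mul, ← h1]
        simp only [mulVec, dotProduct]
        refine (norm_sum_le _ _).trans (Finset.sum_le_sum fun j _ => ?_)
        simp [abs_of_nonneg (hT i j)]
    rw [← ENNReal.ofReal_coe_nnreal, coe_nnnorm]
    exact ENNReal.ofReal_le_ofReal h
  · have hmem : (r : ℂ) ∈ spectrum ℂ (T.map (algebraMap ℝ ℂ)) := by
      refine (mem_spectrum_iff_exists_mulVec _ _).2 ⟨fun i => (x i : ℂ), fun h => hx0 ?_, ?_⟩
      · funext i
        simpa using congrFun h i
      · funext i
        have h1 := congrFun hx i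
        simp only [mulVec, dotProduct, Pi.smul_apply, smul_eq_mul] at h1 ⊢
        simpa using congrArg (fun y : ℝ => (y : ℂ)) h1
    refine le_trans (le_of_eq ?_) (le_iSup₂ (f := fun μ (_ : μ ∈ _) => (‖μ‖₊ : ENNReal)) _ hmem)
    rw [← ENNReal.ofReal_coe_nnreal, coe_nnnorm]
    simp [abs_of_nonneg hr]

/-- Transposition preserves the spectrum, so left and right Perron vectors belong to the same root.
-/
theorem exists_rho_eq [NeZero n] {T : Matrix (Fin n) (Fin n) ℝ} (hT : ∀ i j, 0 ≤ T i j) :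
    ∃ r : ℝ, 0 ≤ r ∧ rho T = ENNReal.ofReal r ∧
      (∃ x : Fin n → ℝ, (∀ i, 0 ≤ x i) ∧ x ≠ 0 ∧ T *ᵥ x = r • x) ∧
      (∃ y : Fin n → ℝ, (∀ i, 0 ≤ y i) ∧ y ≠ 0 ∧ y ᵥ* T = r • y) ∧
      ∀ (t : ℝ) (v : Fin n → ℝ), (∀ i, 0 ≤ v i) → v ≠ 0 →
        (∀ i, t * v i ≤ (T *ᵥ v) i) → t ≤ r := by
  obtain ⟨r, hr, ⟨x, hx, hx0, hxe⟩, hmax⟩ := exists_perron T hT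
  obtain ⟨s, hs, ⟨y, hy, hy0, hye⟩, hmax'⟩ := exists_perron Tᵀ fun i j => hT j i
  have h1 := rho_eq_ofReal hT hr hx0 hxe hmax
  have h2 := rho_eq_ofReal (T := Tᵀ) (fun i j => hT j i) hs hy0 hye hmax'
  rw [rho_transpose, h1, ENNReal.ofReal_eq_ofReal_iff hr hs] at h2
  subst h2
  exact ⟨r, hr, h1, ⟨x, hx, hx0, hxe⟩, ⟨y, hy, hy0, by rwa [mulVec_transpose] at hye⟩, hmax⟩

end SpectralRadius

/-! ### The splitting behind the AOR matrix. -/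

section Splitting

variable {n : ℕ}

/-- The matrix `D - γ L` of the AOR splitting of `B = D - L - U`. -/
def aorLeft (γ : ℝ) (B : Matrix (Fin n) (Fin n) ℝ) : Matrix (Fin n) (Fin n) ℝ :=
  diagPart B - γ • (-lowerPart B)

/-- The matrix `(1 - γ) L + U` of the AOR splitting of `B = D - L - U`. -/
def aorRight (γ : ℝ) (B : Matrix (Fin n) (Fin n) ℝ) : Matrix (Fin n) (Fin n) ℝ :=
  (1 - γ) • (-lowerPart B) + (-upperPart B)

theorem aorLeft_apply (γ : ℝ) (B : Matrix (Fin n) (Fin n) ℝ) (i j : Fin n) :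
    aorLeft γ B i j = if i = j then B i j else if j < i then γ * B i j else 0 := by
  rcases lt_trichotomy i j with h | h | h
  · simp [aorLeft, diagPart, lowerPart, h.ne, h.not_gt]
  · simp [aorLeft, diagPart, lowerPart, h]
  · simp [aorLeft, diagPart, lowerPart, h.ne', h]

theorem aorRight_apply (γ : ℝ) (B : Matrix (Fin n) (Fin n) ℝ) (i j : Fin n) :
    aorRight γ B i j = if j < i then -((1 - γ) * B i j) else if i < j then -B i j else 0 := by
  rcases lt_trichotomy i j with h | h | h
  · simp [aorRight, upperPart, lowerPart, h, h.not_gt]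
  · simp [aorRight, upperPart, lowerPart, h]
  · simp [aorRight, upperPart, lowerPart, h.not_gt, h]

theorem aorLeft_sub_aorRight (γ : ℝ) (B : Matrix (Fin n) (Fin n) ℝ) :
    aorLeft γ B - aorRight γ B = B := by
  ext i j
  rw [Matrix.sub_apply, aorLeft_apply, aorRight_apply]
  rcases lt_trichotomy i j with h | h | h
  · simp [h, h.ne, h.not_gt]
  · simp [h]
  · simp only [h.ne', h, if_true, if_false]; ring

theorem aorMatrix_eq (γ ω : ℝ) (B : Matrix (Fin n) (Fin n) ℝ) :
    aorMatrix γ ω B = (aorLeft γ B)⁻¹ * ((1 - ω) • aorLeft γ B + ω • aorRight γ B) := by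
  unfold aorMatrix aorLeft aorRight
  congr 1
  module

theorem isUnit_det_aorLeft {γ : ℝ} {B : Matrix (Fin n) (Fin n) ℝ} (hD : ∀ i, 0 < B i i) :
    IsUnit (aorLeft γ B).det := by
  rw [Matrix.det_of_isLowerTriangular, isUnit_iff_ne_zero, Finset.prod_ne_zero_iff]
  · intro i _
    simpa [aorLeft_apply] using (hD i).ne'
  · intro i j hij
    have hij : i < j := hij
    simp [aorLeft_apply, hij.ne, hij.not_gt]

/-- Forward substitution: the matrix is lower triangular with positive diagonal and nonpositive
entries below it. -/
theorem nonneg_of_aorLeft_mulVec_nonneg {γ : ℝ} (hγ : 0 ≤ γ) {B : Matrix (Fin n) (Fin n) ℝ}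
    (hD : ∀ i, 0 < B i i) (hB : IsZMatrix B) {v : Fin n → ℝ}
    (hv : ∀ i, 0 ≤ (aorLeft γ B *ᵥ v) i) (i : Fin n) : 0 ≤ v i := by
  induction i using WellFoundedLT.induction with
  | _ i ih =>
    have h := hv i
    rw [mulVec, dotProduct, ← Finset.add_sum_erase _ _ (Finset.mem_univ i)] at h
    have h1 : ∑ j ∈ Finset.univ.erase i, aorLeft γ B i j * v j ≤ 0 := by
      refine Finset.sum_nonpos fun j hj => ?_
      have hne : j ≠ i := Finset.ne_of_mem_erase hj
      rw [aorLeft_apply, if_neg hne.symm]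
      split_ifs with hlt
      · exact mul_nonpos_of_nonpos_of_nonneg
          (mul_nonpos_of_nonneg_of_nonpos hγ (hB i j hne.symm)) (ih j hlt)
      · simp
    rw [aorLeft_apply, if_pos rfl] at h
    have h2 : 0 ≤ B i i * v i := by linarith
    exact nonneg_of_mul_nonneg_right h2 (hD i)

theorem aorLeft_inv_nonneg {γ : ℝ} (hγ : 0 ≤ γ) {B : Matrix (Fin n) (Fin n) ℝ}
    (hD : ∀ i, 0 < B i i) (hB : IsZMatrix B) (i j : Fin n) : 0 ≤ (aorLeft γ B)⁻¹ i j := by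
  have h := nonneg_of_aorLeft_mulVec_nonneg hγ hD hB
    (v := (aorLeft γ B)⁻¹ *ᵥ Pi.single j 1) (fun k => by
      rw [mulVec_mulVec, mul_nonsing_inv _ (isUnit_det_aorLeft hD), one_mulVec]
      rcases eq_or_ne k j with rfl | hk
      · simp
      · simp [hk]) i
  simpa using h

theorem aorRight_nonneg {γ : ℝ} (hγ : γ ≤ 1) {B : Matrix (Fin n) (Fin n) ℝ}
    (hB : IsZMatrix B) (i j : Fin n) : 0 ≤ aorRight γ B i j := by
  rw [aorRight_apply]
  split_ifs with h1 h2
  · have := mul_nonpos_of_nonneg_of_nonpos (sub_nonneg.2 hγ) (hB i j h1.ne')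
    linarith
  · have := hB i j h2.ne
    linarith
  · exact le_rfl

theorem mul_nonneg_entries {X Y : Matrix (Fin n) (Fin n) ℝ} (hX : ∀ i j, 0 ≤ X i j)
    (hY : ∀ i j, 0 ≤ Y i j) (i j : Fin n) : 0 ≤ (X * Y) i j := by
  simp only [mul_apply]
  exact Finset.sum_nonneg fun k _ => mul_nonneg (hX i k) (hY k j)

theorem mulVec_nonneg_entries {X : Matrix (Fin n) (Fin n) ℝ} (hX : ∀ i j, 0 ≤ X i j)
    {v : Fin n → ℝ} (hv : ∀ i, 0 ≤ v i) (i : Fin n) : 0 ≤ (X *ᵥ v) i := by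
  simp only [mulVec, dotProduct]
  exact Finset.sum_nonneg fun k _ => mul_nonneg (hX i k) (hv k)

theorem mul_eq_zero_of_mulVec_eq_zero {X : Matrix (Fin n) (Fin n) ℝ} (hX : ∀ i j, 0 ≤ X i j)
    {v : Fin n → ℝ} (hv : ∀ i, 0 ≤ v i) {i : Fin n} (h : (X *ᵥ v) i = 0) (j : Fin n) :
    X i j * v j = 0 := by
  simp only [mulVec, dotProduct] at h
  exact (Finset.sum_eq_zero_iff_of_nonneg fun k _ => mul_nonneg (hX i k) (hv k)).1 h j
    (Finset.mem_univ j)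

theorem vecMul_nonneg_entries {X : Matrix (Fin n) (Fin n) ℝ} (hX : ∀ i j, 0 ≤ X i j)
    {v : Fin n → ℝ} (hv : ∀ i, 0 ≤ v i) (i : Fin n) : 0 ≤ (v ᵥ* X) i := by
  simp only [vecMul, dotProduct]
  exact Finset.sum_nonneg fun k _ => mul_nonneg (hv k) (hX k i)

/-- The spectral radius of the AOR matrix of a Z-matrix with positive diagonal is
`1 - ω + ω τ`, where `τ` is the Perron root of the pencil of the splitting. -/
theorem exists_rho_aorMatrix [NeZero n] {γ ω : ℝ} (hω₀ : 0 < ω) (hω₁ : ω ≤ 1) (hγ₀ : 0 ≤ γ)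
    (hγ₁ : γ ≤ 1) {B : Matrix (Fin n) (Fin n) ℝ} (hD : ∀ i, 0 < B i i) (hB : IsZMatrix B) :
    ∃ τ : ℝ, 0 ≤ τ ∧ rho (aorMatrix γ ω B) = ENNReal.ofReal (1 - ω + ω * τ) ∧
      (∃ x : Fin n → ℝ, (∀ i, 0 ≤ x i) ∧ x ≠ 0 ∧
        aorRight γ B *ᵥ x = τ • (aorLeft γ B *ᵥ x)) ∧
      (∃ z : Fin n → ℝ, (∀ i, 0 ≤ z i) ∧ z ≠ 0 ∧ z ᵥ* aorRight γ B = τ • (z ᵥ* aorLeft γ B) ∧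
        ∀ i, 0 ≤ (z ᵥ* aorLeft γ B) i) ∧
      ∀ (t : ℝ) (v : Fin n → ℝ), (∀ i, 0 ≤ v i) → v ≠ 0 →
        (∀ i, t * (aorLeft γ B *ᵥ v) i ≤ (aorRight γ B *ᵥ v) i) → t ≤ τ := by
  set M := aorLeft γ B with hM
  set N := aorRight γ B with hN
  have hdet : IsUnit M.det := isUnit_det_aorLeft hD
  have hMinv : ∀ i j, 0 ≤ M⁻¹ i j := aorLeft_inv_nonneg hγ₀ hD hB
  have hNn : ∀ i j, 0 ≤ N i j := aorRight_nonneg hγ₁ hB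
  have hTn : ∀ i j, 0 ≤ (M⁻¹ * N) i j := mul_nonneg_entries hMinv hNn
  have haor : aorMatrix γ ω B = (1 - ω) • (1 : Matrix (Fin n) (Fin n) ℝ) + ω • (M⁻¹ * N) := by
    rw [aorMatrix_eq, ← hM, ← hN, mul_add, Matrix.mul_smul, Matrix.mul_smul, nonsing_inv_mul _ hdet]
  have hvec : ∀ v : Fin n → ℝ, aorMatrix γ ω B *ᵥ v = (1 - ω) • v + ω • ((M⁻¹ * N) *ᵥ v) := by
    intro v
    rw [haor, add_mulVec, smul_mulVec, smul_mulVec, one_mulVec]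
  have hAn : ∀ i j, 0 ≤ aorMatrix γ ω B i j := by
    intro i j
    rw [haor]
    refine add_nonneg (mul_nonneg (by linarith) ?_) (mul_nonneg hω₀.le (hTn i j))
    rw [one_apply]; split_ifs <;> simp
  obtain ⟨r, hr, hrho, ⟨x, hx, hx0, hxe⟩, ⟨y, hy, hy0, hye⟩, hmax⟩ := exists_rho_eq hAn
  -- This inverts `r = 1 - ω + ωτ`. Nonnegativity of `τ` does not follow from `r ≥ 0`; it is read
  -- off `M⁻¹N x = τ x`.
  set τ := (r - (1 - ω)) / ω with hτ
  have hrτ : r = 1 - ω + ω * τ := by rw [hτ]; field_simp; ring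
  have hxT : (M⁻¹ * N) *ᵥ x = τ • x := by
    rw [hvec] at hxe
    funext i
    have h := congrFun hxe i
    simp only [Pi.add_apply, Pi.smul_apply, smul_eq_mul] at h ⊢
    rw [hrτ] at h
    exact mul_left_cancel₀ hω₀.ne' (by linarith)
  have hyT : y ᵥ* (M⁻¹ * N) = τ • y := by
    rw [haor, vecMul_add, vecMul_smul, vecMul_smul, vecMul_one] at hye
    funext i
    have h := congrFun hye i
    simp only [Pi.add_apply, Pi.smul_apply, smul_eq_mul] at h ⊢
    rw [hrτ] at h
    exact mul_left_cancel₀ hω₀.ne' (by linarith)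
  have hzM : (y ᵥ* M⁻¹) ᵥ* M = y := by
    rw [vecMul_vecMul, nonsing_inv_mul _ hdet, vecMul_one]
  refine ⟨τ, ?_, by rw [hrho, hrτ], ⟨x, hx, hx0, ?_⟩,
    ⟨y ᵥ* M⁻¹, vecMul_nonneg_entries hMinv hy, ?_, ?_, ?_⟩, fun t v hv hv0 h => ?_⟩
  · obtain ⟨i, hi⟩ := Function.ne_iff.1 hx0
    have h1 : 0 ≤ τ * x i := by
      have := mulVec_nonneg_entries hTn hx i
      rwa [hxT] at this
    exact nonneg_of_mul_nonneg_left h1 (lt_of_le_of_ne (hx i) (Ne.symm hi))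
  · rw [← mulVec_smul, ← hxT, mulVec_mulVec, ← mul_assoc, mul_nonsing_inv _ hdet, one_mul]
  · intro h
    rw [h, zero_vecMul] at hzM
    exact hy0 hzM.symm
  · rw [hzM, vecMul_vecMul, hyT]
  · rwa [hzM]
  · have h1 : ∀ i, t * v i ≤ ((M⁻¹ * N) *ᵥ v) i := by
      intro i
      have h2 := mulVec_nonneg_entries hMinv (v := N *ᵥ v - t • (M *ᵥ v))
        (fun i => by simpa using h i) i
      rw [mulVec_sub, mulVec_smul, mulVec_mulVec, mulVec_mulVec, nonsing_inv_mul _ hdet,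
        one_mulVec] at h2
      simpa using h2
    have h3 := hmax (1 - ω + ω * t) v hv hv0 fun i => by
      rw [hvec]
      simp only [Pi.add_apply, Pi.smul_apply, smul_eq_mul]
      have := mul_le_mul_of_nonneg_left (h1 i) hω₀.le
      linarith
    rw [hrτ] at h3
    exact le_of_mul_le_mul_left (by linarith) hω₀

end Splitting

/-! ### Irreducibility in terms of index sets. -/

section Irreducible

variable {n : ℕ}

/-- An irreducible matrix has a nonzero entry leading out of every proper nonempty index set. -/
theorem IsIrreducible.exists_ne_zero {B : Matrix (Fin n) (Fin n) ℝ} (hB : IsIrreducible B)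
    {S : Set (Fin n)} (hS : S.Nonempty) (hS' : S ≠ Set.univ) :
    ∃ i ∈ S, ∃ j ∉ S, B i j ≠ 0 := by
  classical
  by_contra! hzero
  refine hB ?_
  -- The permutation will list the complement of `S` first, so that the zero block has its rows in
  -- `S` and its columns outside.
  set r := Fintype.card {i // i ∉ S} with hr
  have hr1 : 1 ≤ r := by
    obtain ⟨j, hj⟩ := (Set.ne_univ_iff_exists_notMem S).1 hS'
    exact Fintype.card_pos_iff.2 ⟨⟨j, hj⟩⟩
  have hrn : r < n := by
    obtain ⟨i, hi⟩ := hS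
    have h := Fintype.card_subtype_lt (p := fun i => i ∉ S) (x := i) (not_not.2 hi)
    rwa [Fintype.card_fin] at h
  have hcard : Fintype.card {i : Fin n // (i : ℕ) < r} = Fintype.card {i // i ∉ S} := by
    rw [Fintype.card_subtype, Fin.card_filter_val_lt, min_eq_right hrn.le]
  set e := Fintype.equivOfCardEq hcard with he
  refine ⟨e.extendSubtype, r, hr1, hrn, fun i j hi hj => ?_⟩
  have h1 : e.extendSubtype i ∈ S :=
    not_not.1 (e.extendSubtype_not_mem i (not_lt.2 hi))
  exact hzero _ h1 _ (e.extendSubtype_mem j hj)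

theorem IsIrreducible.exists_offDiag_ne_zero [Nontrivial (Fin n)] {B : Matrix (Fin n) (Fin n) ℝ}
    (hB : IsIrreducible B) (i : Fin n) : ∃ j ≠ i, B i j ≠ 0 := by
  obtain ⟨j₀, hj₀⟩ := exists_ne i
  obtain ⟨i', rfl, j, hj, hij⟩ := hB.exists_ne_zero (S := {i}) (Set.singleton_nonempty i)
    (fun h => hj₀ (Set.mem_singleton_iff.1 (h ▸ Set.mem_univ j₀)))
  exact ⟨j, hj, hij⟩

end Irreducible

/-! ### Zero patterns of Perron vectors of the pencil. -/

section Pencil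

variable {n : ℕ}

/-- The weight is `1` above the diagonal and `1 - γ + τγ` below it, positive even for `γ = 1`
because `τ > 0`. Hence vanishing sums in the pencil equations detect zero entries of `B` itself. -/
theorem aorRight_sub_aorLeft_apply {γ τ : ℝ} (hγ₀ : 0 ≤ γ) (hγ₁ : γ ≤ 1) (hτ : 0 < τ)
    (B : Matrix (Fin n) (Fin n) ℝ) {i j : Fin n} (hij : i ≠ j) :
    ∃ κ > 0, aorRight γ B i j - τ * aorLeft γ B i j = κ * -B i j := by
  rw [aorRight_apply, aorLeft_apply, if_neg hij]
  rcases lt_or_gt_of_ne hij with h | h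
  · exact ⟨1, one_pos, by simp [h, h.not_gt]⟩
  · refine ⟨1 - γ + τ * γ, ?_, by simp only [h, if_true]; ring⟩
    rcases hγ₁.lt_or_eq with h1 | h1
    · have := mul_nonneg hτ.le hγ₀
      linarith
    · rw [h1]; linarith

theorem eq_zero_of_right_pencil {γ τ : ℝ} (hγ₀ : 0 ≤ γ) (hγ₁ : γ ≤ 1) (hτ : 0 < τ)
    {B : Matrix (Fin n) (Fin n) ℝ} (hB : IsZMatrix B) {x : Fin n → ℝ} (hx : ∀ i, 0 ≤ x i)
    (hxe : aorRight γ B *ᵥ x = τ • (aorLeft γ B *ᵥ x)) {i j : Fin n} (hi : x i = 0)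
    (hj : x j ≠ 0) : B i j = 0 := by
  have hsum : ∑ k, (aorRight γ B i k - τ * aorLeft γ B i k) * x k = 0 := by
    have h := congrFun hxe i
    simp only [Pi.smul_apply, smul_eq_mul, mulVec, dotProduct, Finset.mul_sum] at h
    rw [← sub_eq_zero, ← Finset.sum_sub_distrib] at h
    rw [← h]
    exact Finset.sum_congr rfl fun k _ => by ring
  have hnn : ∀ k ∈ Finset.univ, 0 ≤ (aorRight γ B i k - τ * aorLeft γ B i k) * x k := by
    intro k _
    rcases eq_or_ne i k with rfl | hik
    · simp [hi]
    · obtain ⟨κ, hκ, h⟩ := aorRight_sub_aorLeft_apply hγ₀ hγ₁ hτ B hik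
      rw [h]
      exact mul_nonneg (mul_nonneg hκ.le (neg_nonneg.2 (hB i k hik))) (hx k)
  have h := (Finset.sum_eq_zero_iff_of_nonneg hnn).1 hsum j (Finset.mem_univ j)
  obtain ⟨κ, hκ, h'⟩ := aorRight_sub_aorLeft_apply hγ₀ hγ₁ hτ B
    (show i ≠ j from fun e => hj (e ▸ hi))
  rw [h'] at h
  simpa [hκ.ne', hj] using h

theorem pos_of_right_pencil {γ τ : ℝ} (hγ₀ : 0 ≤ γ) (hγ₁ : γ ≤ 1) (hτ : 0 < τ)
    {B : Matrix (Fin n) (Fin n) ℝ} (hB : IsZMatrix B) (hirr : IsIrreducible B)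
    {x : Fin n → ℝ} (hx : ∀ i, 0 ≤ x i) (hx0 : x ≠ 0)
    (hxe : aorRight γ B *ᵥ x = τ • (aorLeft γ B *ᵥ x)) (i : Fin n) : 0 < x i := by
  refine lt_of_le_of_ne (hx i) fun hi => ?_
  obtain ⟨j, hj⟩ := Function.ne_iff.1 hx0
  obtain ⟨k, hk, l, hl, hkl⟩ := hirr.exists_ne_zero (S := {k | x k = 0}) ⟨i, hi.symm⟩
    (fun h => hj (h.symm ▸ Set.mem_univ j : j ∈ {k | x k = 0}))
  exact hkl (eq_zero_of_right_pencil hγ₀ hγ₁ hτ hB hx hxe hk hl)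

theorem sum_left_pencil {γ τ : ℝ} {B : Matrix (Fin n) (Fin n) ℝ} {z : Fin n → ℝ}
    (hze : z ᵥ* aorRight γ B = τ • (z ᵥ* aorLeft γ B)) (j : Fin n) :
    ∑ k, z k * (aorRight γ B k j - τ * aorLeft γ B k j) = 0 := by
  have h := congrFun hze j
  simp only [Pi.smul_apply, smul_eq_mul, vecMul, dotProduct, Finset.mul_sum] at h
  rw [← sub_eq_zero, ← Finset.sum_sub_distrib] at h
  rw [← h]
  exact Finset.sum_congr rfl fun k _ => by ring

theorem eq_zero_of_left_pencil {γ τ : ℝ} (hγ₀ : 0 ≤ γ) (hγ₁ : γ ≤ 1) (hτ : 0 < τ)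
    {B : Matrix (Fin n) (Fin n) ℝ} (hB : IsZMatrix B) {z : Fin n → ℝ} (hz : ∀ i, 0 ≤ z i)
    (hze : z ᵥ* aorRight γ B = τ • (z ᵥ* aorLeft γ B)) {i j : Fin n} (hi : z i ≠ 0)
    (hj : z j = 0) : B i j = 0 := by
  have hnn : ∀ k ∈ Finset.univ, 0 ≤ z k * (aorRight γ B k j - τ * aorLeft γ B k j) := by
    intro k _
    rcases eq_or_ne k j with rfl | hkj
    · simp [hj]
    · obtain ⟨κ, hκ, h⟩ := aorRight_sub_aorLeft_apply hγ₀ hγ₁ hτ B hkj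
      rw [h]
      exact mul_nonneg (hz k) (mul_nonneg hκ.le (neg_nonneg.2 (hB k j hkj)))
  have h := (Finset.sum_eq_zero_iff_of_nonneg hnn).1 (sum_left_pencil hze j) i (Finset.mem_univ i)
  obtain ⟨κ, hκ, h'⟩ := aorRight_sub_aorLeft_apply hγ₀ hγ₁ hτ B
    (show i ≠ j from fun e => hi (e ▸ hj))
  rw [h'] at h
  simpa [hκ.ne', hi] using h

/-- In column `j` the diagonal contributes `-τ B j j z j ≠ 0`, which some off-diagonal term must
balance. This keeps the support of `z` from being a singleton. -/
theorem exists_ne_zero_of_left_pencil {γ τ : ℝ} (hγ₀ : 0 ≤ γ) (hγ₁ : γ ≤ 1) (hτ : 0 < τ)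
    {B : Matrix (Fin n) (Fin n) ℝ} (hD : ∀ i, 0 < B i i) {z : Fin n → ℝ}
    (hze : z ᵥ* aorRight γ B = τ • (z ᵥ* aorLeft γ B)) {j : Fin n} (hj : z j ≠ 0) :
    ∃ i ≠ j, z i ≠ 0 ∧ B i j ≠ 0 := by
  by_contra! h
  have hsum := sum_left_pencil hze j
  rw [Finset.sum_eq_single j] at hsum
  · rw [aorRight_apply, aorLeft_apply] at hsum
    simp [hj, hτ.ne', (hD j).ne'] at hsum
  · intro k _ hkj
    obtain ⟨κ, hκ, h'⟩ := aorRight_sub_aorLeft_apply hγ₀ hγ₁ hτ B hkj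
    rw [h']
    by_cases hk : z k = 0
    · simp [hk]
    · simp [h k hkj hk]
  · simp

/-- The Perron root of the pencil of an irreducible Z-matrix with unit diagonal is positive. -/
theorem exists_pos_subinvariant {m : ℕ} [Nontrivial (Fin (m + 1))] {γ : ℝ} (hγ₁ : γ ≤ 1)
    {B : Matrix (Fin (m + 1)) (Fin (m + 1)) ℝ} (hD : ∀ i, B i i = 1) (hB : IsZMatrix B)
    (hirr : IsIrreducible B) :
    ∃ t : ℝ, 0 < t ∧ ∃ v : Fin (m + 1) → ℝ, (∀ i, 0 ≤ v i) ∧ v ≠ 0 ∧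
      ∀ i, t * (aorLeft γ B *ᵥ v) i ≤ (aorRight γ B *ᵥ v) i := by
  set c : Fin (m + 1) → ℝ := fun i => ∑ j ∈ Finset.univ.erase i, -B i j with hc
  have hcpos : ∀ i, 0 < c i := by
    intro i
    obtain ⟨j, hji, hj⟩ := hirr.exists_offDiag_ne_zero i
    refine Finset.sum_pos' (fun k hk => neg_nonneg.2 (hB i k (Finset.ne_of_mem_erase hk).symm))
      ⟨j, Finset.mem_erase.2 ⟨hji, Finset.mem_univ j⟩, ?_⟩
    exact neg_pos.2 (lt_of_le_of_ne (hB i j hji.symm) hj)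
  obtain ⟨k, -, hk⟩ := Finset.exists_min_image Finset.univ c Finset.univ_nonempty
  set θ := min 1 (c k) with hθ
  have hθ0 : 0 < θ := lt_min one_pos (hcpos k)
  have hθ1 : θ ≤ 1 := min_le_left _ _
  have hθc : ∀ i, θ ≤ c i := fun i => (min_le_right _ _).trans (hk i (Finset.mem_univ i))
  have ht1 : θ ^ (m + 1) ≤ 1 := pow_le_one₀ hθ0.le hθ1
  -- With these powers every off-diagonal term in row `i` is at least `θ ^ (m + i) * -B i j`: below
  -- the diagonal because `m + 1 + j ≤ m + i`, above it because `j ≤ m + i`. As `c i ≥ θ`, their sum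
  -- covers the diagonal cost `θ ^ (m + 1 + i)`.
  refine ⟨θ ^ (m + 1), pow_pos hθ0 _, fun i => θ ^ (i : ℕ), fun i => (pow_pos hθ0 _).le,
    fun h => (pow_pos hθ0 _).ne' (congrFun h 0), fun i => ?_⟩
  simp only [mulVec, dotProduct, Finset.mul_sum]
  rw [← sub_nonneg, ← Finset.sum_sub_distrib, ← Finset.add_sum_erase _ _ (Finset.mem_univ i)]
  have h1 : θ ^ (m + i) * c i ≤ ∑ j ∈ Finset.univ.erase i, (aorRight γ B i j * θ ^ (j : ℕ) -
      θ ^ (m + 1) * (aorLeft γ B i j * θ ^ (j : ℕ))) := by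
    rw [hc, Finset.mul_sum]
    refine Finset.sum_le_sum fun j hj => ?_
    have hji : j ≠ i := Finset.ne_of_mem_erase hj
    have hb : 0 ≤ -B i j := neg_nonneg.2 (hB i j hji.symm)
    rw [aorRight_apply, aorLeft_apply, if_neg hji.symm]
    rcases lt_or_gt_of_ne hji with h | h
    · have hp : θ ^ (m + i) ≤ θ ^ (m + 1) * θ ^ (j : ℕ) := by
        rw [← pow_add]
        exact pow_le_pow_of_le_one hθ0.le hθ1 (by have : (j : ℕ) < i := h; omega)
      simp only [h, if_true]
      have h2 : θ ^ (m + 1) ≤ 1 - γ + θ ^ (m + 1) * γ := by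
        nlinarith [mul_nonneg (sub_nonneg.2 hγ₁) (sub_nonneg.2 ht1)]
      calc θ ^ (m + i) * -B i j ≤ θ ^ (m + 1) * θ ^ (j : ℕ) * -B i j :=
            mul_le_mul_of_nonneg_right hp hb
        _ ≤ (1 - γ + θ ^ (m + 1) * γ) * θ ^ (j : ℕ) * -B i j := by gcongr
        _ = _ := by ring
    · have hp : θ ^ (m + i) ≤ θ ^ (j : ℕ) :=
        pow_le_pow_of_le_one hθ0.le hθ1 (by omega)
      simp only [h, h.not_gt, if_true, if_false]
      have := mul_le_mul_of_nonneg_right hp hb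
      linarith
  have h2 : θ ^ (m + i) * θ ≤ θ ^ (m + i) * c i :=
    mul_le_mul_of_nonneg_left (hθc i) (pow_pos hθ0 _).le
  have h3 : θ ^ (m + 1) * θ ^ (i : ℕ) = θ ^ (m + i) * θ := by ring
  rw [aorRight_apply, aorLeft_apply]
  simp only [lt_irrefl, if_true, if_false, hD]
  linarith

end Pencil

/-! ### Triangular parts and the identity `W = Δ(γ) + γQᵘA`. -/

section Parts

variable {n : ℕ} (X Y : Matrix (Fin n) (Fin n) ℝ)

theorem diagPart_add : diagPart (X + Y) = diagPart X + diagPart Y := by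
  ext i j; simp only [diagPart, of_apply, Matrix.add_apply]; split_ifs <;> simp

theorem lowerPart_add : lowerPart (X + Y) = lowerPart X + lowerPart Y := by
  ext i j; simp only [lowerPart, of_apply, Matrix.add_apply]; split_ifs <;> simp

theorem diagPart_neg : diagPart (-X) = -diagPart X := by
  ext i j; simp only [diagPart, of_apply, Matrix.neg_apply]; split_ifs <;> simp

theorem lowerPart_neg : lowerPart (-X) = -lowerPart X := by
  ext i j; simp only [lowerPart, of_apply, Matrix.neg_apply]; split_ifs <;> simp

theorem diagPart_one : diagPart (1 : Matrix (Fin n) (Fin n) ℝ) = 1 := by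
  ext i j; simp only [diagPart, of_apply, one_apply]; split_ifs <;> simp

theorem lowerPart_one : lowerPart (1 : Matrix (Fin n) (Fin n) ℝ) = 0 := by
  ext i j
  simp only [lowerPart, of_apply, one_apply, Matrix.zero_apply]
  split_ifs with h1 h2 <;> simp_all

theorem diagPart_lowerPart : diagPart (lowerPart X) = 0 := by
  ext i j
  simp only [diagPart, lowerPart, of_apply, Matrix.zero_apply]
  split_ifs with h1 h2 <;> simp_all

theorem diagPart_upperPart : diagPart (upperPart X) = 0 := by
  ext i j
  simp only [diagPart, upperPart, of_apply, Matrix.zero_apply]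
  split_ifs with h1 h2 <;> simp_all

theorem lowerPart_lowerPart : lowerPart (lowerPart X) = lowerPart X := by
  ext i j
  simp only [lowerPart, of_apply]
  split_ifs <;> rfl

theorem lowerPart_upperPart : lowerPart (upperPart X) = 0 := by
  ext i j
  simp only [lowerPart, upperPart, of_apply, Matrix.zero_apply]
  split_ifs with h1 h2
  · exact absurd h2 h1.not_gt
  · rfl
  · rfl

theorem lowerPart_mul_lowerPart_apply_of_le {i j : Fin n} (h : i ≤ j) :
    (lowerPart X * lowerPart Y) i j = 0 := by
  rw [mul_apply]
  refine Finset.sum_eq_zero fun k _ => ?_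
  simp only [lowerPart, of_apply]
  split_ifs with h1 h2
  · exact absurd (h2.trans h1) h.not_gt
  all_goals simp

theorem upperPart_mul_upperPart_apply_of_le {i j : Fin n} (h : j ≤ i) :
    (upperPart X * upperPart Y) i j = 0 := by
  rw [mul_apply]
  refine Finset.sum_eq_zero fun k _ => ?_
  simp only [upperPart, of_apply]
  split_ifs with h1 h2
  · exact absurd (h1.trans h2) h.not_gt
  all_goals simp

theorem diagPart_lowerPart_mul_lowerPart : diagPart (lowerPart X * lowerPart Y) = 0 := by
  ext i j
  simp only [diagPart, of_apply, Matrix.zero_apply]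
  split_ifs with h
  · exact lowerPart_mul_lowerPart_apply_of_le X Y h.le
  · rfl

theorem diagPart_upperPart_mul_upperPart : diagPart (upperPart X * upperPart Y) = 0 := by
  ext i j
  simp only [diagPart, of_apply, Matrix.zero_apply]
  split_ifs with h
  · exact upperPart_mul_upperPart_apply_of_le X Y h.ge
  · rfl

theorem lowerPart_lowerPart_mul_lowerPart :
    lowerPart (lowerPart X * lowerPart Y) = lowerPart X * lowerPart Y := by
  ext i j
  rw [lowerPart, of_apply]
  split_ifs with h
  · rfl
  · exact (lowerPart_mul_lowerPart_apply_of_le X Y (not_lt.1 h)).symm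

theorem lowerPart_upperPart_mul_upperPart : lowerPart (upperPart X * upperPart Y) = 0 := by
  ext i j
  rw [lowerPart, of_apply]
  split_ifs with h
  · exact upperPart_mul_upperPart_apply_of_le X Y h.le
  · rfl

theorem eq_diagPart_add_lowerPart_add_upperPart :
    X = diagPart X + lowerPart X + upperPart X := by
  ext i j
  simp only [diagPart, lowerPart, upperPart, of_apply, Matrix.add_apply]
  rcases lt_trichotomy i j with h | h | h
  · simp [h, h.ne, h.not_gt]
  · simp [h]
  · simp [h, h.ne', h.not_gt]

/-- The comparison of the splittings of `A` and `(1 + Q) A`. -/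
theorem one_add_mul_aorLeft_sub {A Q : Matrix (Fin n) (Fin n) ℝ} (hA : ∀ i, A i i = 1)
    (hQ : ∀ i, Q i i = 0) (γ : ℝ) :
    (1 + Q) * aorLeft γ A - aorLeft γ ((1 + Q) * A) = Delta A Q γ + γ • (upperPart Q * A) := by
  have hdA : diagPart A = 1 := by
    ext i j
    simp only [diagPart, of_apply, one_apply]
    split_ifs with h
    · rw [← h, hA]
    · rfl
  have hdQ : diagPart Q = 0 := by
    ext i j
    simp only [diagPart, of_apply, Matrix.zero_apply]
    split_ifs with h
    · rw [← h, hQ]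
    · rfl
  have eA : A = 1 + lowerPart A + upperPart A := by
    conv_lhs => rw [eq_diagPart_add_lowerPart_add_upperPart A, hdA]
  have eQ : Q = lowerPart Q + upperPart Q := by
    conv_lhs => rw [eq_diagPart_add_lowerPart_add_upperPart Q, hdQ, zero_add]
  have hPA : (1 + Q) * A = 1 + lowerPart A + upperPart A + lowerPart Q + upperPart Q
      + lowerPart Q * lowerPart A + lowerPart Q * upperPart A + upperPart Q * lowerPart A
      + upperPart Q * upperPart A := by
    conv_lhs => rw [eA, eQ]
    noncomm_ring
  have hD : diagPart ((1 + Q) * A) = 1 + diagPart (lowerPart Q * upperPart A)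
      + diagPart (upperPart Q * lowerPart A) := by
    rw [hPA]
    simp only [diagPart_add, diagPart_one, diagPart_lowerPart, diagPart_upperPart,
      diagPart_lowerPart_mul_lowerPart, diagPart_upperPart_mul_upperPart]
    abel
  have hL : lowerPart ((1 + Q) * A) = lowerPart A + lowerPart Q + lowerPart Q * lowerPart A
      + lowerPart (lowerPart Q * upperPart A) + lowerPart (upperPart Q * lowerPart A) := by
    rw [hPA]
    simp only [lowerPart_add, lowerPart_one, lowerPart_lowerPart, lowerPart_upperPart,
      lowerPart_lowerPart_mul_lowerPart, lowerPart_upperPart_mul_upperPart]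
    abel
  have hQA : upperPart Q * A = upperPart Q + upperPart Q * lowerPart A
      + upperPart Q * upperPart A := by
    conv_lhs => rw [eA]
    noncomm_ring
  have hQs : (1 - γ) • Q = (1 - γ) • lowerPart Q + (1 - γ) • upperPart Q := by
    conv_lhs => rw [eQ]
    rw [smul_add]
  have hPM : (1 + Q) * (1 - γ • -lowerPart A) = 1 + lowerPart Q + upperPart Q + γ • lowerPart A
      + γ • (lowerPart Q * lowerPart A) + γ • (upperPart Q * lowerPart A) := by
    have h1 : 1 + Q = 1 + lowerPart Q + upperPart Q := by rw [add_assoc, ← eQ]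
    rw [h1]
    simp only [smul_neg, sub_neg_eq_add, add_mul, mul_add, Matrix.mul_smul, one_mul, mul_one]
    abel
  rw [aorLeft, aorLeft, hD, hL, hdA, hPM, Delta, hQA, hQs]
  simp only [mul_neg, diagPart_neg, lowerPart_neg]
  module

end Parts

/-! ### Signs of the entries of `Δ(γ)`. -/

section DeltaEntries

variable {n : ℕ}

theorem IsAdmissible.nonneg {Q : Matrix (Fin n) (Fin n) ℝ} (hQ : IsAdmissible Q) (i j : Fin n) :
    0 ≤ Q i j := by
  rcases eq_or_ne i j with rfl | h
  · exact (hQ.diag_eq_zero i).ge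
  · exact hQ.offDiag_nonneg i j h

theorem IsAdmissible.exists_pos {Q : Matrix (Fin n) (Fin n) ℝ} (hQ : IsAdmissible Q) :
    ∃ i j, 0 < Q i j := by
  obtain ⟨p, -, hp⟩ := Finset.exists_ne_zero_of_sum_ne_zero hQ.sum_ne_zero
  exact ⟨p.1, p.2, lt_of_le_of_ne (hQ.nonneg _ _) (Ne.symm hp)⟩

theorem IsAdmissible.ne_of_pos {Q : Matrix (Fin n) (Fin n) ℝ} (hQ : IsAdmissible Q) {i j : Fin n}
    (h : 0 < Q i j) : i ≠ j := by
  rintro rfl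
  exact h.ne' (hQ.diag_eq_zero i)

theorem diagPart_nonneg {X : Matrix (Fin n) (Fin n) ℝ} (hX : ∀ i j, 0 ≤ X i j) (i j : Fin n) :
    0 ≤ diagPart X i j := by
  simp only [diagPart, of_apply]
  split_ifs
  exacts [hX i j, le_rfl]

theorem lowerPart_nonneg {X : Matrix (Fin n) (Fin n) ℝ} (hX : ∀ i j, 0 ≤ X i j) (i j : Fin n) :
    0 ≤ lowerPart X i j := by
  simp only [lowerPart, of_apply]
  split_ifs
  exacts [hX i j, le_rfl]

theorem upperPart_nonneg {X : Matrix (Fin n) (Fin n) ℝ} (hX : ∀ i j, 0 ≤ X i j) (i j : Fin n) :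
    0 ≤ upperPart X i j := by
  simp only [upperPart, of_apply]
  split_ifs
  exacts [hX i j, le_rfl]

theorem IsZMatrix.neg_lowerPart_nonneg {A : Matrix (Fin n) (Fin n) ℝ} (hA : IsZMatrix A)
    (i j : Fin n) : 0 ≤ (-lowerPart A) i j := by
  simp only [Matrix.neg_apply, lowerPart, of_apply]
  split_ifs with h
  · exact neg_nonneg.2 (hA i j h.ne')
  · simp

theorem IsZMatrix.neg_upperPart_nonneg {A : Matrix (Fin n) (Fin n) ℝ} (hA : IsZMatrix A)
    (i j : Fin n) : 0 ≤ (-upperPart A) i j := by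
  simp only [Matrix.neg_apply, upperPart, of_apply]
  split_ifs with h
  · exact neg_nonneg.2 (hA i j h.ne)
  · simp

variable {A Q : Matrix (Fin n) (Fin n) ℝ}

theorem le_Delta (hA : IsZMatrix A) (hQ : IsAdmissible Q) {γ : ℝ} (hγ₀ : 0 ≤ γ) (i j : Fin n) :
    (1 - γ) * Q i j ≤ Delta A Q γ i j := by
  have hl := lowerPart_nonneg hQ.nonneg
  have hu := upperPart_nonneg hQ.nonneg
  have h1 := mul_nonneg_entries hl hA.neg_upperPart_nonneg
  have h2 := mul_nonneg_entries hu hA.neg_lowerPart_nonneg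
  have h3 := mul_nonneg_entries hu hA.neg_upperPart_nonneg
  have h4 := diagPart_nonneg h1 i j
  have h5 := diagPart_nonneg h2 i j
  have h6 := mul_nonneg hγ₀ (lowerPart_nonneg h1 i j)
  have h7 := mul_nonneg hγ₀ (lowerPart_nonneg h2 i j)
  have h8 := mul_nonneg hγ₀ (h3 i j)
  simp only [Delta, Matrix.add_apply, Matrix.smul_apply, smul_eq_mul]
  linarith

theorem Delta_nonneg (hA : IsZMatrix A) (hQ : IsAdmissible Q) {γ : ℝ} (hγ₀ : 0 ≤ γ)
    (hγ₁ : γ ≤ 1) (i j : Fin n) : 0 ≤ Delta A Q γ i j :=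
  (mul_nonneg (sub_nonneg.2 hγ₁) (hQ.nonneg i j)).trans (le_Delta hA hQ hγ₀ i j)

theorem Delta_pos_of_lt_one (hA : IsZMatrix A) (hQ : IsAdmissible Q) {γ : ℝ} (hγ₀ : 0 ≤ γ)
    (hγ₁ : γ < 1) {i j : Fin n} (hij : 0 < Q i j) : 0 < Delta A Q γ i j :=
  (mul_pos (sub_pos.2 hγ₁) hij).trans_le (le_Delta hA hQ hγ₀ i j)

theorem mul_apply_pos {X Y : Matrix (Fin n) (Fin n) ℝ} (hX : ∀ i j, 0 ≤ X i j)
    (hY : ∀ i j, 0 ≤ Y i j) {i k j : Fin n} (h₁ : 0 < X i k) (h₂ : 0 < Y k j) :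
    0 < (X * Y) i j := by
  rw [mul_apply]
  exact Finset.sum_pos' (fun l _ => mul_nonneg (hX i l) (hY l j))
    ⟨k, Finset.mem_univ k, mul_pos h₁ h₂⟩

theorem diagPart_add_lowerPart_pos {X : Matrix (Fin n) (Fin n) ℝ} {i j : Fin n} (hji : j ≤ i)
    (h : 0 < X i j) : 0 < diagPart X i j + lowerPart X i j := by
  rcases hji.lt_or_eq with h1 | h1
  · simpa [diagPart, lowerPart, h1, h1.ne'] using h
  · simpa [diagPart, lowerPart, h1] using h

/-- The products `q_{ik} a_{kj}` that contribute to `Δ(1)`. -/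
theorem Delta_one_pos (hA : IsZMatrix A) (hQ : IsAdmissible Q) {i k j : Fin n}
    (hq : 0 < Q i k) (ha : A k j < 0)
    (h : (j ≤ i ∧ k < j) ∨ i < k ∧ (j ≤ i ∨ k < j)) : 0 < Delta A Q 1 i j := by
  have hl := lowerPart_nonneg hQ.nonneg
  have hu := upperPart_nonneg hQ.nonneg
  have h1 := mul_nonneg_entries hl hA.neg_upperPart_nonneg
  have h2 := mul_nonneg_entries hu hA.neg_lowerPart_nonneg
  have h3 := mul_nonneg_entries hu hA.neg_upperPart_nonneg i j
  have h4 := diagPart_nonneg h1 i j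
  have h5 := diagPart_nonneg h2 i j
  have h6 := lowerPart_nonneg h1 i j
  have h7 := lowerPart_nonneg h2 i j
  simp only [Delta, Matrix.add_apply, Matrix.smul_apply, smul_eq_mul, one_mul, sub_self, zero_mul]
  -- The three cases are `k < j ≤ i`, seen by `E₁ + F₁`; `j ≤ i < k`, seen by `E₂ + F₂`; and `i < k
  -- < j`, seen by `QᵘU`.
  rcases h with ⟨hji, hkj'⟩ | ⟨hik, hji | hkj'⟩
  · have hki : k < i := hkj'.trans_le hji
    have := diagPart_add_lowerPart_pos hji
      (mul_apply_pos hl hA.neg_upperPart_nonneg (i := i) (k := k) (j := j)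
        (by simpa [lowerPart, hki] using hq) (by simpa [upperPart, hkj'] using ha))
    linarith
  · have hjk : j < k := hji.trans_lt hik
    have := diagPart_add_lowerPart_pos hji
      (mul_apply_pos hu hA.neg_lowerPart_nonneg (i := i) (k := k) (j := j)
        (by simpa [upperPart, hik] using hq) (by simpa [lowerPart, hjk] using ha))
    linarith
  · have := mul_apply_pos hu hA.neg_upperPart_nonneg (i := i) (k := k) (j := j)
      (by simpa [upperPart, hik] using hq) (by simpa [upperPart, hkj'] using ha)
    linarith

theorem IsAdmissible.of_mul_neg (hQ : IsAdmissible Q) (hD : ∀ i, A i i = 1) {i k j : Fin n}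
    (h : Q i k * A k j < 0) : 0 < Q i k ∧ A k j < 0 ∧ i ≠ k ∧ k ≠ j := by
  have hq : 0 < Q i k := by
    refine lt_of_le_of_ne (hQ.nonneg i k) fun h0 => ?_
    simp [← h0] at h
  have ha : A k j < 0 := (pos_iff_neg_of_mul_neg h).1 hq
  refine ⟨hq, ha, hQ.ne_of_pos hq, ?_⟩
  rintro rfl
  rw [hD] at ha
  linarith

theorem Delta_one_pos_of_mul_neg (hA : IsZMatrix A) (hQ : IsAdmissible Q) (hD : ∀ i, A i i = 1)
    {i k j : Fin n} (hneg : Q i k * A k j < 0)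
    (h : (j ≤ i ∧ k < j) ∨ i < k ∧ (j ≤ i ∨ k < j)) : 0 < Delta A Q 1 i j := by
  obtain ⟨hq, ha, -, -⟩ := hQ.of_mul_neg hD hneg
  exact Delta_one_pos hA hQ hq ha h

end DeltaEntries

/-! ### The listed alternatives produce positive entries of `Δ(1)`. -/

section Conditions

variable {m : ℕ} {A Q : Matrix (Fin (m + 1)) (Fin (m + 1)) ℝ}

theorem IsAdmissible.nontrivial (hQ : IsAdmissible Q) : Nontrivial (Fin (m + 1)) := by
  obtain ⟨i, j, h⟩ := hQ.exists_pos
  exact ⟨i, j, hQ.ne_of_pos h⟩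

theorem exists_Delta_pos_of_diag (hA : IsZMatrix A) (hQ : IsAdmissible Q) (hD : ∀ i, A i i = 1)
    {i j : Fin (m + 1)} (h : Q i j * A j i < 0) : ∃ j, 0 < Delta A Q 1 i j := by
  obtain ⟨-, -, h1, -⟩ := hQ.of_mul_neg hD h
  refine ⟨i, Delta_one_pos_of_mul_neg hA hQ hD h ?_⟩
  rcases lt_or_gt_of_ne h1 with h2 | h2
  · exact Or.inr ⟨h2, Or.inl le_rfl⟩
  · exact Or.inl ⟨le_rfl, h2⟩

theorem exists_Delta_pos_of_superdiag (hA : IsZMatrix A) (hQ : IsAdmissible Q)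
    (hD : ∀ i, A i i = 1) {i : Fin (m + 1)} {j : Fin m}
    (h : Q i j.castSucc * A j.castSucc j.succ < 0) : ∃ j, 0 < Delta A Q 1 i j := by
  obtain ⟨-, -, h1, -⟩ := hQ.of_mul_neg hD h
  refine ⟨j.succ, Delta_one_pos_of_mul_neg hA hQ hD h ?_⟩
  rcases lt_or_gt_of_ne h1 with h2 | h2
  · exact Or.inr ⟨h2, Or.inr Fin.castSucc_lt_succ⟩
  · exact Or.inl ⟨Fin.castSucc_lt_iff_succ_le.1 h2, Fin.castSucc_lt_succ⟩

/-- Irreducibility gives row `i + 1` of `A` a negative off-diagonal entry. Its column is at most `i`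
or beyond `i + 1`, and both positions contribute; no column lies between. -/
theorem exists_Delta_pos_of_succ (hA : IsZMatrix A) (hQ : IsAdmissible Q)
    (hirr : IsIrreducible A) {i : Fin m} (h : 0 < Q i.castSucc i.succ) :
    ∃ j, 0 < Delta A Q 1 i.castSucc j := by
  have := hQ.nontrivial
  obtain ⟨j, hj, hj0⟩ := hirr.exists_offDiag_ne_zero i.succ
  refine ⟨j, Delta_one_pos hA hQ h (lt_of_le_of_ne (hA _ _ hj.symm) hj0)
    (Or.inr ⟨Fin.castSucc_lt_succ, ?_⟩)⟩
  rcases lt_or_gt_of_ne hj with h2 | h2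
  · exact Or.inl (Fin.le_castSucc_iff.2 h2)
  · exact Or.inr h2

theorem exists_Delta_pos_last (hA : IsZMatrix A) (hQ : IsAdmissible Q)
    (hirr : IsIrreducible A) (h : 0 < Q (Fin.last m) 0) :
    ∃ j, 0 < Delta A Q 1 (Fin.last m) j := by
  have := hQ.nontrivial
  obtain ⟨j, hj, hj0⟩ := hirr.exists_offDiag_ne_zero 0
  exact ⟨j, Delta_one_pos hA hQ h (lt_of_le_of_ne (hA _ _ hj.symm) hj0)
    (Or.inl ⟨Fin.le_last j, Fin.pos_iff_ne_zero.2 hj⟩)⟩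

theorem RowCond.exists_Delta_pos (hA : IsZMatrix A) (hQ : IsAdmissible Q) (hD : ∀ i, A i i = 1)
    (hirr : IsIrreducible A) {i : Fin m} (h : RowCond A Q i) :
    ∃ j, 0 < Delta A Q 1 i.castSucc j := by
  cases h with
  | r1 h => exact h
  | r2 h => exact exists_Delta_pos_of_succ hA hQ hirr h
  | r3 h =>
    obtain ⟨j, h⟩ := h
    exact exists_Delta_pos_of_diag hA hQ hD h
  | r4 h =>
    obtain ⟨j, hj, h⟩ := h
    exact ⟨j, Delta_one_pos_of_mul_neg hA hQ hD h (Or.inr ⟨Fin.castSucc_lt_last i, Or.inl hj⟩)⟩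
  | r5 h =>
    obtain ⟨j, hj, h⟩ := h
    exact ⟨0, Delta_one_pos_of_mul_neg hA hQ hD h (Or.inr ⟨hj, Or.inl (Fin.zero_le _)⟩)⟩
  | r6 h =>
    obtain ⟨j, h⟩ := h
    exact exists_Delta_pos_of_superdiag hA hQ hD h

theorem RowCond7.exists_Delta_pos (hA : IsZMatrix A) (hQ : IsAdmissible Q)
    (hD : ∀ i, A i i = 1) {i : Fin m} (h : RowCond7 A Q i) :
    ∃ j, 0 < Delta A Q 1 i.castSucc j := by
  obtain ⟨j, hj0, hj, h⟩ := h
  exact ⟨j, Delta_one_pos_of_mul_neg hA hQ hD h (Or.inl ⟨hj, hj0⟩)⟩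

theorem EntryCond.exists_Delta_pos (hA : IsZMatrix A) (hQ : IsAdmissible Q)
    (hD : ∀ i, A i i = 1) (hirr : IsIrreducible A) (h : EntryCond A Q) :
    ∃ i j, 0 < Delta A Q 1 i j := by
  cases h with
  | c1 h => exact h
  | c2 h => exact ⟨_, exists_Delta_pos_last hA hQ hirr h⟩
  | c3 h =>
    obtain ⟨k, h⟩ := h
    exact ⟨_, exists_Delta_pos_of_succ hA hQ hirr h⟩
  | c4 h =>
    obtain ⟨i, j, h⟩ := h
    exact ⟨i, exists_Delta_pos_of_diag hA hQ hD h⟩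
  | c5 h =>
    obtain ⟨i, j, hi, hj, h⟩ := h
    exact ⟨i, j, Delta_one_pos_of_mul_neg hA hQ hD h (Or.inr ⟨hi, Or.inl hj⟩)⟩
  | c6 h =>
    obtain ⟨i, j, -, hj, h⟩ := h
    exact ⟨i, 0, Delta_one_pos_of_mul_neg hA hQ hD h (Or.inr ⟨hj, Or.inl (Fin.zero_le _)⟩)⟩
  | c7 h =>
    obtain ⟨i, j, h⟩ := h
    exact ⟨i, exists_Delta_pos_of_superdiag hA hQ hD h⟩
  | c8 h =>
    obtain ⟨i, j, -, hj0, hj, h⟩ := h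
    exact ⟨i, j, Delta_one_pos_of_mul_neg hA hQ hD h (Or.inl ⟨hj, hj0⟩)⟩
  | c9 h =>
    obtain ⟨h0, h⟩ := h
    obtain ⟨i, j, hq⟩ := hQ.exists_pos
    -- Any positive `Q i j` suffices: it meets the superdiagonal entry of row `j`, or the entry `A
    -- (Fin.last m) 0` when `j` is the last index.
    rcases Fin.eq_castSucc_or_eq_last j with ⟨k, rfl⟩ | rfl
    · exact ⟨i, exists_Delta_pos_of_superdiag hA hQ hD (mul_neg_of_pos_of_neg hq (h k))⟩
    · exact ⟨i, 0, Delta_one_pos hA hQ hq h0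
        (Or.inr ⟨Fin.lt_last_iff_ne_last.2 (hQ.ne_of_pos hq), Or.inl (Fin.zero_le _)⟩)⟩

end Conditions

/-! ### Consequences of monotonicity. -/

section MMatrix

variable {n : ℕ}

theorem IsMonotone.nonpos_of_mulVec_nonpos {A : Matrix (Fin n) (Fin n) ℝ} (hA : IsMonotone A)
    {v : Fin n → ℝ} (hv : ∀ i, (A *ᵥ v) i ≤ 0) (i : Fin n) : v i ≤ 0 := by
  have h := mulVec_nonneg_entries hA.2.1 (v := -(A *ᵥ v)) (fun i => by simpa using hv i) i
  rw [mulVec_neg, mulVec_mulVec, nonsing_inv_mul _ ((isUnit_iff_isUnit_det A).1 hA.1),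
    one_mulVec] at h
  simpa using h

theorem IsMonotone.nonpos_of_vecMul_nonpos {A : Matrix (Fin n) (Fin n) ℝ} (hA : IsMonotone A)
    {v : Fin n → ℝ} (hv : ∀ i, (v ᵥ* A) i ≤ 0) (i : Fin n) : v i ≤ 0 := by
  have h := vecMul_nonneg_entries hA.2.1 (v := -(v ᵥ* A)) (fun i => by simpa using hv i) i
  rw [neg_vecMul, vecMul_vecMul, mul_nonsing_inv _ ((isUnit_iff_isUnit_det A).1 hA.1),
    vecMul_one] at h
  simpa using h

/-- The diagonal of a Z-matrix `(1 + Q) A` with `A` monotone and `Q ≥ 0` is positive. -/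
theorem diag_pos_of_isMonotone {A Q : Matrix (Fin n) (Fin n) ℝ} (hA : IsMonotone A)
    (hQ : ∀ i j, 0 ≤ Q i j) (hZ : IsZMatrix ((1 + Q) * A)) (i : Fin n) :
    0 < ((1 + Q) * A) i i := by
  -- For this `u ≥ 0` one has `(1 + Q)Au = 1 + Q1 ≥ 1`, and off-diagonal terms cannot supply a
  -- positive value.
  set u : Fin n → ℝ := A⁻¹ *ᵥ 1 with hu
  have hu0 : ∀ i, 0 ≤ u i := mulVec_nonneg_entries hA.2.1 fun _ => zero_le_one
  have hAu : A *ᵥ u = 1 := by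
    rw [hu, mulVec_mulVec, mul_nonsing_inv _ ((isUnit_iff_isUnit_det A).1 hA.1), one_mulVec]
  have h1 : 1 ≤ (((1 + Q) * A) *ᵥ u) i := by
    rw [← mulVec_mulVec, hAu, add_mulVec, one_mulVec]
    simpa using mulVec_nonneg_entries hQ (v := 1) (fun _ => zero_le_one) i
  rw [mulVec, dotProduct, ← Finset.add_sum_erase _ _ (Finset.mem_univ i)] at h1
  have h2 : ∑ j ∈ Finset.univ.erase i, ((1 + Q) * A) i j * u j ≤ 0 :=
    Finset.sum_nonpos fun j hj => mul_nonpos_of_nonpos_of_nonneg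
      (hZ i j (Finset.ne_of_mem_erase hj).symm) (hu0 j)
  exact pos_of_mul_pos_left (by linarith) (hu0 i)

end MMatrix

/-! ### Comparison of the Perron roots and exclusion of the obstruction. -/

section Comparison

variable {m : ℕ} {A Q : Matrix (Fin (m + 1)) (Fin (m + 1)) ℝ}

/-- Either preconditioning strictly decreases the spectral radius, or there is an index set `S`,
the support of a left Perron vector for `(1 + Q) A`, on which the two splittings agree along the
right Perron vector `x` for `A`. -/
theorem rho_lt_or_exists_support {γ ω : ℝ} (hω₀ : 0 < ω) (hω₁ : ω ≤ 1) (hγ₀ : 0 ≤ γ)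
    (hγ₁ : γ ≤ 1) (hD : ∀ i, A i i = 1) (hirr : IsIrreducible A) (hM : IsNonsingularMMatrix A)
    (hQ : IsAdmissible Q) (hZ : IsZMatrix ((1 + Q) * A)) :
    rho (aorMatrix γ ω A) < 1 ∧
      (rho (aorMatrix γ ω ((1 + Q) * A)) < rho (aorMatrix γ ω A) ∨
        ∃ (x : Fin (m + 1) → ℝ) (S : Set (Fin (m + 1))), (∀ i, 0 < x i) ∧
          (∃ s : ℝ, 0 < s ∧ aorLeft γ A *ᵥ x = s • (aorRight γ A *ᵥ x)) ∧ (∀ i, 0 ≤ (A *ᵥ x) i) ∧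
          S.Nonempty ∧ (∀ i ∈ S, ∀ j ∉ S, ((1 + Q) * A) i j = 0) ∧
          (∀ j ∈ S, ∃ i ∈ S, i ≠ j ∧ ((1 + Q) * A) i j ≠ 0) ∧
          ∀ i ∈ S, (((1 + Q) * aorLeft γ A - aorLeft γ ((1 + Q) * A)) *ᵥ x) i = 0) := by
  have := hQ.nontrivial
  have hA := hM.1
  have hD1 := diag_pos_of_isMonotone hM.2 hQ.nonneg hZ
  obtain ⟨τ, hτ0, hrho, ⟨x, hx, hx0, hxe⟩, -, hmax⟩ := exists_rho_aorMatrix hω₀ hω₁ hγ₀ hγ₁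
    (fun i => by rw [hD]; exact one_pos) hA
  obtain ⟨τ₁, -, hrho₁, -, ⟨z, hz, hz0, hze, hzM⟩, -⟩ := exists_rho_aorMatrix hω₀ hω₁ hγ₀ hγ₁
    hD1 hZ
  have hτ : 0 < τ := by
    obtain ⟨t, ht, v, hv, hv0, h⟩ := exists_pos_subinvariant hγ₁ hD hA hirr
    exact ht.trans_le (hmax t v hv hv0 h)
  have hxpos := pos_of_right_pencil hγ₀ hγ₁ hτ hA hirr hx hx0 hxe
  have hMx : aorLeft γ A *ᵥ x = τ⁻¹ • (aorRight γ A *ᵥ x) := by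
    rw [hxe, inv_smul_smul₀ hτ.ne']
  have hMxn : ∀ i, 0 ≤ (aorLeft γ A *ᵥ x) i := fun i => by
    rw [hMx]
    exact mul_nonneg (inv_nonneg.2 hτ0) (mulVec_nonneg_entries (aorRight_nonneg hγ₁ hA) hx i)
  have hAx : A *ᵥ x = (1 - τ) • (aorLeft γ A *ᵥ x) := by
    conv_lhs => rw [← aorLeft_sub_aorRight γ A]
    rw [sub_mulVec, hxe, sub_smul, one_smul]
  -- If `τ ≥ 1` then `Ax ≤ 0`, and monotonicity would give `x ≤ 0`.
  have hτ1 : τ < 1 := by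
    by_contra! h
    have := hM.2.nonpos_of_mulVec_nonpos (v := x) (fun i => by
      rw [hAx]
      exact mul_nonpos_of_nonpos_of_nonneg (sub_nonpos.2 h) (hMxn i)) 0
    exact (hxpos 0).not_ge this
  have hAxn : ∀ i, 0 ≤ (A *ᵥ x) i := fun i => by
    rw [hAx]
    exact mul_nonneg (sub_nonneg.2 hτ1.le) (hMxn i)
  have hωτ : 0 < ω * τ := mul_pos hω₀ hτ
  refine ⟨?_, ?_⟩
  · rw [hrho, ENNReal.ofReal_lt_one]
    have := mul_lt_mul_of_pos_left hτ1 hω₀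
    linarith
  rcases lt_or_ge τ₁ τ with hlt | hge
  · left
    rw [hrho, hrho₁, ENNReal.ofReal_lt_ofReal_iff (by linarith)]
    have := mul_lt_mul_of_pos_left hlt hω₀
    linarith
  right
  have hτ₁ : 0 < τ₁ := hτ.trans_le hge
  set W := (1 + Q) * aorLeft γ A - aorLeft γ ((1 + Q) * A) with hW
  -- The summand `γQᵘA` may have negative entries; it is handled through `Ax ≥ 0`.
  have hWn : ∀ i, 0 ≤ (W *ᵥ x) i := by
    intro i
    rw [hW, one_add_mul_aorLeft_sub hD hQ.diag_eq_zero, add_mulVec, smul_mulVec, ← mulVec_mulVec]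
    exact add_nonneg (mulVec_nonneg_entries (Delta_nonneg hA hQ hγ₀ hγ₁) hx i)
      (mul_nonneg hγ₀ (mulVec_nonneg_entries (upperPart_nonneg hQ.nonneg) hAxn i))
  have hpencil : aorRight γ ((1 + Q) * A) *ᵥ x - τ • (aorLeft γ ((1 + Q) * A) *ᵥ x) =
      -((1 - τ) • (W *ᵥ x)) := by
    have h2 : ((1 + Q) * A) *ᵥ x = (1 - τ) • (((1 + Q) * aorLeft γ A) *ᵥ x) := by
      rw [← mulVec_mulVec, hAx, mulVec_smul, mulVec_mulVec]
    have h3 : ((1 + Q) * A) *ᵥ x =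
        aorLeft γ ((1 + Q) * A) *ᵥ x - aorRight γ ((1 + Q) * A) *ᵥ x := by
      rw [← sub_mulVec, aorLeft_sub_aorRight]
    have h1 : aorRight γ ((1 + Q) * A) *ᵥ x =
        aorLeft γ ((1 + Q) * A) *ᵥ x - (1 - τ) • (((1 + Q) * aorLeft γ A) *ᵥ x) := by
      rw [← h2, h3, sub_sub_cancel]
    rw [h1, hW, sub_mulVec]
    module
  -- For `τ₁ ≥ τ` the left side is nonnegative and the right side nonpositive, so `z ⬝ᵥ (W *ᵥ x)`
  -- vanishes.
  have hdot : (τ₁ - τ) * ((z ᵥ* aorLeft γ ((1 + Q) * A)) ⬝ᵥ x) = -((1 - τ) * (z ⬝ᵥ (W *ᵥ x))) := by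
    have h := congrArg (fun v => z ⬝ᵥ v) hpencil
    simp only [dotProduct_sub, dotProduct_smul, dotProduct_neg, dotProduct_mulVec, hze,
      smul_dotProduct, smul_eq_mul] at h ⊢
    linarith
  have hzW : z ⬝ᵥ (W *ᵥ x) = 0 := by
    have h1 : 0 ≤ z ⬝ᵥ (W *ᵥ x) := Finset.sum_nonneg fun i _ => mul_nonneg (hz i) (hWn i)
    have h2 : 0 ≤ (z ᵥ* aorLeft γ ((1 + Q) * A)) ⬝ᵥ x :=
      Finset.sum_nonneg fun i _ => mul_nonneg (hzM i) (hx i)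
    have h3 := mul_nonneg (sub_nonneg.2 hge) h2
    have h4 : (1 - τ) * (z ⬝ᵥ (W *ᵥ x)) ≤ 0 := by linarith
    exact le_antisymm (nonpos_of_mul_nonpos_right h4 (sub_pos.2 hτ1)) h1
  refine ⟨x, {i | z i ≠ 0}, hxpos, ⟨τ⁻¹, inv_pos.2 hτ, hMx⟩, hAxn, Function.ne_iff.1 hz0,
    fun i hi j hj => eq_zero_of_left_pencil hγ₀ hγ₁ hτ₁ hZ hz hze hi (not_not.1 hj),
    fun j hj => ?_, fun i hi => ?_⟩
  · obtain ⟨i, hij, hi, h⟩ := exists_ne_zero_of_left_pencil hγ₀ hγ₁ hτ₁ hD1 hze hj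
    exact ⟨i, hi, hij, h⟩
  · have h := (Finset.sum_eq_zero_iff_of_nonneg
      fun i _ => mul_nonneg (hz i) (hWn i)).1 hzW i (Finset.mem_univ i)
    exact (mul_eq_zero.1 h).resolve_left hi

theorem Delta_eq_zero {γ : ℝ} (hγ₀ : 0 ≤ γ) (hγ₁ : γ ≤ 1) (hD : ∀ i, A i i = 1)
    (hA : IsZMatrix A) (hQ : IsAdmissible Q) {x : Fin (m + 1) → ℝ} (hx : ∀ i, 0 < x i)
    (hAx : ∀ i, 0 ≤ (A *ᵥ x) i) {i : Fin (m + 1)}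
    (hi : (((1 + Q) * aorLeft γ A - aorLeft γ ((1 + Q) * A)) *ᵥ x) i = 0) (j : Fin (m + 1)) :
    Delta A Q γ i j = 0 := by
  rw [one_add_mul_aorLeft_sub hD hQ.diag_eq_zero, add_mulVec, smul_mulVec, ← mulVec_mulVec] at hi
  have h1 := mulVec_nonneg_entries (Delta_nonneg hA hQ hγ₀ hγ₁) (fun i => (hx i).le) i
  have h2 := mul_nonneg hγ₀ (mulVec_nonneg_entries (upperPart_nonneg hQ.nonneg) hAx i)
  simp only [Pi.add_apply, Pi.smul_apply, smul_eq_mul] at hi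
  have h3 : (Delta A Q γ *ᵥ x) i = 0 := by linarith
  have h4 := mul_eq_zero_of_mulVec_eq_zero (Delta_nonneg hA hQ hγ₀ hγ₁) (fun j => (hx j).le) h3 j
  exact (mul_eq_zero.1 h4).resolve_right (hx j).ne'

theorem one_add_mul_apply (i j : Fin (m + 1)) :
    ((1 + Q) * A) i j = A i j + ∑ k, Q i k * A k j := by
  rw [add_mul, one_mul, Matrix.add_apply, mul_apply]

/-- Identifies the expression in alternative `c` of `LastRowCond`: the term `k = j` is `Q (Fin.last
m) j` as `A j j = 1`, and the last term drops out as `Q` has zero diagonal. -/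
theorem last_row_apply (hD : ∀ i, A i i = 1) (hQ : IsAdmissible Q) (j : Fin (m + 1)) :
    ((1 + Q) * A) (Fin.last m) j = A (Fin.last m) j + Q (Fin.last m) j
        + ∑ k with k ≠ j ∧ k < Fin.last m, Q (Fin.last m) k * A k j := by
  rw [one_add_mul_apply, ← Finset.add_sum_erase _ _ (Finset.mem_univ j), hD, mul_one, add_assoc]
  congr 2
  symm
  refine Finset.sum_subset (fun k hk => ?_) fun k hk hk' => ?_
  · simp only [Finset.mem_filter] at hk
    exact Finset.mem_erase.2 ⟨hk.2.1, Finset.mem_univ k⟩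
  · have h1 : k = Fin.last m := by
      by_contra h
      exact hk' (Finset.mem_filter.2 ⟨Finset.mem_univ k, Finset.ne_of_mem_erase hk,
        Fin.lt_last_iff_ne_last.2 h⟩)
    rw [h1, hQ.diag_eq_zero, zero_mul]

/-- Under the Stein–Rosenberg type conditions no index set can be an obstruction. -/
theorem SteinRosenbergCond.false_of_support {γ : ℝ} (hD : ∀ i, A i i = 1)
    (hirr : IsIrreducible A) (hA : IsZMatrix A) (hQ : IsAdmissible Q)
    (hcond : SteinRosenbergCond A Q γ) {S : Set (Fin (m + 1))} (hS : S.Nonempty)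
    (hout : ∀ i ∈ S, ∀ j ∉ S, ((1 + Q) * A) i j = 0)
    (hin : ∀ j ∈ S, ∃ i ∈ S, i ≠ j ∧ ((1 + Q) * A) i j ≠ 0)
    (hdelta : ∀ i ∈ S, ∀ j, Delta A Q γ i j = 0) : False := by
  have huniv : IsIrreducible ((1 + Q) * A) → S = Set.univ := by
    intro h
    by_contra hne
    obtain ⟨i, hi, j, hj, hij⟩ := h.exists_ne_zero hS hne
    exact hij (hout i hi j hj)
  have hsingle : ∀ k, ¬ S ⊆ {k} := by
    intro k hk
    obtain ⟨j, hj⟩ := hS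
    obtain ⟨i, hi, hij, -⟩ := hin j hj
    exact hij ((hk hi).trans (hk hj).symm)
  cases hcond with
  | i hγ₀ hγ₁ h =>
    obtain ⟨i, j, hij⟩ := hQ.exists_pos
    exact (Delta_pos_of_lt_one hA hQ hγ₀ hγ₁ hij).ne'
      (hdelta i (huniv h ▸ Set.mem_univ i) j)
  | ii hγ h hentry =>
    subst hγ
    obtain ⟨i, j, hij⟩ := hentry.exists_Delta_pos hA hQ hD hirr
    exact hij.ne' (hdelta i (huniv h ▸ Set.mem_univ i) j)
  | iii hγ₀ hγ₁ h =>
    refine hsingle (Fin.last m) fun i hi => ?_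
    by_contra hne
    obtain ⟨j, hj⟩ := h i (Fin.lt_last_iff_ne_last.2 hne)
    exact (Delta_pos_of_lt_one hA hQ hγ₀ hγ₁ hj).ne' (hdelta i hi j)
  | iv hγ hrow hlast =>
    subst hγ
    -- The row conditions remove all middle indices, so excluding either end leaves at most a
    -- singleton, which `hsingle` forbids.
    have hends : ∀ i ∈ S, i = 0 ∨ i = Fin.last m := by
      intro i hi
      rcases Fin.eq_castSucc_or_eq_last i with ⟨k, rfl⟩ | rfl
      · by_cases h0 : k.castSucc = 0
        · exact Or.inl h0
        · obtain ⟨j, hj⟩ : ∃ j, 0 < Delta A Q 1 k.castSucc j := by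
            rcases hrow k (Fin.pos_iff_ne_zero.2 h0) with h | h
            · exact h.exists_Delta_pos hA hQ hD hirr
            · exact h.exists_Delta_pos hA hQ hD
          exact absurd (hdelta _ hi j) hj.ne'
      · exact Or.inr rfl
    have hlastrow : (∃ j, 0 < Delta A Q 1 (Fin.last m) j) → False := by
      rintro ⟨j, hj⟩
      refine hsingle 0 fun i hi => (hends i hi).resolve_right ?_
      rintro rfl
      exact hj.ne' (hdelta _ hi j)
    have hfirst : FirstRowCond A Q → False := by
      rintro ⟨i, hi0, hi⟩
      obtain ⟨j, hj⟩ := hi.exists_Delta_pos hA hQ hD hirr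
      refine hsingle (Fin.last m) fun k hk => (hends k hk).resolve_left ?_
      rintro rfl
      rw [hi0] at hj
      exact hj.ne' (hdelta _ hk j)
    cases hlast with
    | a h =>
      obtain ⟨j, k, -, hkj, h⟩ := h
      exact hlastrow ⟨j, Delta_one_pos_of_mul_neg hA hQ hD h (Or.inl ⟨Fin.le_last j, hkj⟩)⟩
    | b h => exact hlastrow (exists_Delta_pos_last hA hQ hirr h)
    | c h =>
      obtain ⟨j, hj0, hjl, h⟩ := h
      rw [← last_row_apply hD hQ j] at h
      -- Were the last index in `S`, the negative entry of its row in the middle column `j` would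
      -- lead out of `S`.
      refine hsingle 0 fun i hi => (hends i hi).resolve_right ?_
      rintro rfl
      refine h.ne (hout _ hi j fun hj => ?_)
      rcases hends j hj with h' | h'
      · exact hj0.ne' h'
      · exact hjl.ne h'
    | d h₁ _ => exact hfirst h₁
    | e h₁ _ => exact hfirst h₁

/-- The only summand `Q i l * A l j` that could be positive is `l = j`, and it vanishes; all
summands but the chosen one can be discarded. -/
theorem one_add_mul_apply_le_of_nonpos (hA : IsZMatrix A) (hQ : IsAdmissible Q)
    {i j : Fin (m + 1)} (hij : Q i j = 0) (k : Fin (m + 1)) :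
    ((1 + Q) * A) i j ≤ A i j + Q i k * A k j := by
  rw [one_add_mul_apply, ← Finset.add_sum_erase _ _ (Finset.mem_univ k), ← add_assoc]
  have : ∑ l ∈ Finset.univ.erase k, Q i l * A l j ≤ 0 := by
    refine Finset.sum_nonpos fun l _ => ?_
    rcases eq_or_ne l j with rfl | hlj
    · simp [hij]
    · exact mul_nonpos_of_nonneg_of_nonpos (hQ.nonneg i l) (hA l j hlj)
  linarith

theorem one_add_mul_diag_le (hD : ∀ i, A i i = 1) (hA : IsZMatrix A) (hQ : IsAdmissible Q)
    (i : Fin (m + 1)) : ((1 + Q) * A) i i ≤ 1 := by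
  simpa [hQ.diag_eq_zero, hD] using
    one_add_mul_apply_le_of_nonpos hA hQ (hQ.diag_eq_zero i) i

/-- Under the condition on the lower triangular parts no index set can be an obstruction. -/
theorem LowerCond.false_of_support {γ : ℝ} (hγ₀ : 0 ≤ γ) (hγ₁ : γ ≤ 1) (hD : ∀ i, A i i = 1)
    (hirr : IsIrreducible A) (hM : IsNonsingularMMatrix A) (hQ : IsAdmissible Q)
    (hZ : IsZMatrix ((1 + Q) * A)) (hcond : LowerCond A Q γ) {x : Fin (m + 1) → ℝ}
    (hx : ∀ i, 0 < x i) (hMx : ∃ s : ℝ, 0 < s ∧ aorLeft γ A *ᵥ x = s • (aorRight γ A *ᵥ x))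
    {S : Set (Fin (m + 1))} (hS : S.Nonempty)
    (hout : ∀ i ∈ S, ∀ j ∉ S, ((1 + Q) * A) i j = 0)
    (hW : ∀ i ∈ S, (((1 + Q) * aorLeft γ A - aorLeft γ ((1 + Q) * A)) *ᵥ x) i = 0) : False := by
  have hA := hM.1
  obtain ⟨hlow, hstrict⟩ := hcond
  obtain ⟨s, hs, hMx⟩ := hMx
  have hN := aorRight_nonneg hγ₁ hA
  have hNx : ∀ i, 0 ≤ (aorRight γ A *ᵥ x) i := mulVec_nonneg_entries hN fun i => (hx i).le
  have hdiff : ∀ i j : Fin (m + 1),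
      0 ≤ (aorLeft γ A - aorLeft γ ((1 + Q) * A) : Matrix _ _ ℝ) i j := by
    intro i j
    rw [Matrix.sub_apply, aorLeft_apply, aorLeft_apply]
    split_ifs with h1 h2
    · rw [← h1, hD]
      exact sub_nonneg.2 (one_add_mul_diag_le hD hA hQ i)
    · rw [← mul_sub]
      exact mul_nonneg hγ₀ (sub_nonneg.2 (hlow i j h2))
    · simp
  -- Here `Wx = s QNx + (M - M₁)x` with both terms nonnegative, so each vanishes on `S`.
  have hsplit : ∀ i ∈ S, (Q *ᵥ (aorRight γ A *ᵥ x)) i = 0 ∧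
      ((aorLeft γ A - aorLeft γ ((1 + Q) * A)) *ᵥ x) i = 0 := by
    intro i hi
    have h1 : (1 + Q) * aorLeft γ A - aorLeft γ ((1 + Q) * A) =
        Q * aorLeft γ A + (aorLeft γ A - aorLeft γ ((1 + Q) * A)) := by
      rw [add_mul, one_mul]; abel
    have h2 := hW i hi
    rw [h1, add_mulVec, ← mulVec_mulVec, hMx, mulVec_smul] at h2
    simp only [Pi.add_apply, Pi.smul_apply, smul_eq_mul] at h2
    have h3 := mulVec_nonneg_entries hQ.nonneg hNx i
    have h4 := mulVec_nonneg_entries hdiff (fun i => (hx i).le) i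
    have h5 := mul_nonneg hs.le h3
    have h6 : s * (Q *ᵥ (aorRight γ A *ᵥ x)) i = 0 := by linarith
    exact ⟨(mul_eq_zero.1 h6).resolve_left hs.ne', by linarith⟩
  have hupper : ∀ i ∈ S, ∀ k, 0 < Q i k → ∀ j, k < j → A k j = 0 := by
    intro i hi k hk j hkj
    have h1 := mul_eq_zero_of_mulVec_eq_zero hQ.nonneg hNx (hsplit i hi).1 k
    have h2 : (aorRight γ A *ᵥ x) k = 0 := (mul_eq_zero.1 h1).resolve_left hk.ne'
    have h3 := mul_eq_zero_of_mulVec_eq_zero hN (fun j => (hx j).le) h2 j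
    have h4 := (mul_eq_zero.1 h3).resolve_right (hx j).ne'
    rw [aorRight_apply, if_neg hkj.not_gt, if_pos hkj] at h4
    exact neg_eq_zero.1 h4
  have hrow : ∀ i ∈ S, ∀ j, aorLeft γ A i j = aorLeft γ ((1 + Q) * A) i j := by
    intro i hi j
    have h1 := mul_eq_zero_of_mulVec_eq_zero hdiff (fun j => (hx j).le) (hsplit i hi).2 j
    exact sub_eq_zero.1 ((mul_eq_zero.1 h1).resolve_right (hx j).ne')
  -- the set of indices in `S` or used by a row of `Q` with index in `S` is closed under `A`
  have hclosed : {k | k ∈ S ∨ ∃ i ∈ S, 0 < Q i k} = Set.univ := by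
    by_contra hne
    obtain ⟨k, hk, j, hj, hkj⟩ := hirr.exists_ne_zero (hS.mono fun i hi => Or.inl hi) hne
    have hjS : j ∉ S := fun h => hj (Or.inl h)
    have hjQ : ∀ i ∈ S, Q i j ≤ 0 := fun i hi => not_lt.1 fun h => hj (Or.inr ⟨i, hi, h⟩)
    have hneg : A k j < 0 := lt_of_le_of_ne
      (hA k j (by rintro rfl; exact hk.elim hjS fun ⟨i, hi, h⟩ => h.not_ge (hjQ i hi))) hkj
    have hq0 : ∀ i ∈ S, Q i j = 0 := fun i hi => le_antisymm (hjQ i hi) (hQ.nonneg i j)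
    rcases hk with hk | ⟨i, hi, hik⟩
    · have := one_add_mul_apply_le_of_nonpos hA hQ (hq0 k hk) k
      rw [hout k hk j hjS, hQ.diag_eq_zero] at this
      linarith
    · have := one_add_mul_apply_le_of_nonpos hA hQ (hq0 i hi) k
      rw [hout i hi j hjS] at this
      have h1 := hA i j (fun h => hjS (h ▸ hi))
      have h2 := mul_neg_of_pos_of_neg hik hneg
      linarith
  -- By `hrow` the strict decrease cannot occur in a row of `S`; below the diagonal the factor `γ >
  -- 0` is cancelled.
  obtain ⟨p, hpS, hpne⟩ : ∃ p, p ∉ S ∧ ∃ j, ((1 + Q) * A) p j ≠ A p j := by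
    rcases hstrict with ⟨p, hp⟩ | ⟨hγ, p, j, hjp, hp⟩
    · refine ⟨p, fun h => ?_, p, by rw [hD]; exact hp.ne⟩
      have h1 := hrow p h p
      rw [aorLeft_apply, aorLeft_apply, if_pos rfl, if_pos rfl, hD] at h1
      exact hp.ne h1.symm
    · refine ⟨p, fun h => ?_, j, hp.ne⟩
      have h1 := hrow p h j
      rw [aorLeft_apply, aorLeft_apply, if_neg hjp.ne', if_pos hjp, if_neg hjp.ne',
        if_pos hjp] at h1
      exact hp.ne (mul_left_cancel₀ hγ.ne' h1).symm
  obtain ⟨i, hi, hip⟩ : ∃ i ∈ S, 0 < Q i p :=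
    ((hclosed ▸ Set.mem_univ p : p ∈ {k | k ∈ S ∨ ∃ i ∈ S, 0 < Q i k})).resolve_left hpS
  -- Row `p` of `QA` is the change made by preconditioning. Beyond the diagonal `A p j = 0` by
  -- `hupper`, so the change is an entry of a Z-matrix; elsewhere entries do not increase.
  -- Monotonicity of `A` then yields `Q p ≤ 0`, so row `p` is unchanged.
  have hrowle : ∀ j, (Q p ᵥ* A) j ≤ 0 := by
    intro j
    have h1 : (Q p ᵥ* A) j = ((1 + Q) * A) p j - A p j := by
      rw [one_add_mul_apply, add_sub_cancel_left]; rfl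
    rw [h1]
    rcases lt_trichotomy p j with h | rfl | h
    · rw [hupper i hi p hip j h, sub_zero]
      exact hZ p j h.ne
    · rw [hD]
      exact sub_nonpos.2 (one_add_mul_diag_le hD hA hQ p)
    · exact sub_nonpos.2 (hlow p j h)
  have hzero : ∀ k, Q p k = 0 := fun k =>
    le_antisymm (hM.2.nonpos_of_vecMul_nonpos hrowle k) (hQ.nonneg p k)
  obtain ⟨j, hj⟩ := hpne
  exact hj (by simp [one_add_mul_apply, hzero])

end Comparison

end AOR

theorem theorem3p4 {m : ℕ} (A Q : Matrix (Fin (m + 1)) (Fin (m + 1)) ℝ) (γ ω : ℝ)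
    (hω₀ : 0 < ω) (hω₁ : ω ≤ 1) (hγ₀ : 0 ≤ γ) (hγ₁ : γ ≤ 1)
    (hdiag : ∀ i, A i i = 1)
    (hirr : AOR.IsIrreducible A) (hM : AOR.IsNonsingularMMatrix A)
    (hQ : AOR.IsAdmissible Q) (hZ : AOR.IsZMatrix ((1 + Q) * A))
    (hcond : AOR.SteinRosenbergCond A Q γ ∨ AOR.LowerCond A Q γ) :
    AOR.rho (AOR.aorMatrix γ ω ((1 + Q) * A)) < AOR.rho (AOR.aorMatrix γ ω A) ∧
      AOR.rho (AOR.aorMatrix γ ω A) < 1 := by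
  obtain ⟨h1, h | ⟨x, S, hx, hMx, hAx, hS, hout, hin, hW⟩⟩ :=
    AOR.rho_lt_or_exists_support hω₀ hω₁ hγ₀ hγ₁ hdiag hirr hM hQ hZ
  · exact ⟨h, h1⟩
  · exfalso
    rcases hcond with hcond | hcond
    · exact hcond.false_of_support hdiag hirr hM.1 hQ hS hout hin fun i hi =>
        AOR.Delta_eq_zero hγ₀ hγ₁ hdiag hM.1 hQ hx hAx (hW i hi)
    · exact hcond.false_of_support hγ₀ hγ₁ hdiag hirr hM hQ hZ hx hMx hS hout hW
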